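/- **Setup.** Let $\xi_1,\xi_2,\dots$ be i.i.d. copies of a strictly positive random variable whose distribution function $G$ has a density $g$ that is bounded and continuous on $(0,\infty)$ with $g(1/2)>0$. For $A\subseteq\{1,\dots,n\}$ put $$f_n(A)=|A|-\sum_{i=1}^{n-1}\xi_i\,1(i\in A,\ i+1\in A),\qquad M_n=\max_{A\subseteq\{1,\dots,n\}}f_n(A),$$ and let $A_n^{opt}$ be a (random) set attaining $M_n$. Fix $\tau>0$ with $G(\tfrac12-\tau)>0$ and a Lagrange multiplier $0<\theta<\tau$. Let $B_n^{opt}$ be a (random) set maximizing $f_n(B)+\theta|B\triangle A_n^{opt}|$ over $B\subseteq\{1,\dots,n\}$. If $1/\theta$ is not an odd integer, arbitrary maximizers are allowed; if $1/\theta$ is an odd integer, $B_n^{opt}$ is the maximizer chosen by the following tie-breaking rule: the smallest item in which it differs from any other maximizer belongs to $B_n^{opt}$. **The stationary quintuple process.** This is a stationary process $(Z^L_i,X^L_i,\xi_i,X^R_{i+1},Z^R_{i+1})_{i\in\mathbb Z}$ in which $(\xi_i)_{i\in\mathbb Z}$ are i.i.d. with distribution function $G$ and, almost surely for all $i\in\mathbb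 Z$, $$X^L_{i+1}=\max(1-X^L_i,1-\xi_i),\qquad X^R_i=\max(1-X^R_{i+1},1-\xi_i),$$ $$Z^L_{i+1}=1-\min(Z^L_i,\xi_i)1(Z^L_i>0)+\theta J_{i+1},\qquad Z^R_i=1-\min(Z^R_{i+1},\xi_i)1(Z^R_{i+1}>0)+\theta J_i,$$ where $J_i=1(i\notin A^{opt})-1(i\in A^{opt})$ and $A^{opt}\subseteq\mathbb Z$ is the random set such that for each $i$: $i,i+1\in A^{opt}$ if $\xi_i<\min(X^L_i,X^R_{i+1})$; $i\in A^{opt},\,i+1\notin A^{opt}$ if $X^R_{i+1}<\min(X^L_i,\xi_i)$; and $i\notin A^{opt},\,i+1\in A^{opt}$ if $X^L_i<\min(X^R_{i+1},\xi_i)$. The random set $B^{opt}\subseteq\mathbb Z$ uses, for each pair $(i,i+1)$, a choice with the largest relative benefit among: include both ($Z^L_i+Z^R_{i+1}-\xi_i$), only $i$ ($Z^L_i$), only $i+1$ ($Z^R_{i+1}$), neither ($0$); ties are broken by requiring that, given the decision at $i$, item $i+1$ is excluded only if this gives strictly larger relative benefit than including it. Define $$\delta(\theta)=P(\{0\in A^{opt}\}\triangle\{0\in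 B^{opt}\}),$$ $$\varepsilon(\theta)=P(0\in A^{opt})-E[\xi_01(0,1\in A^{opt})]-P(0\in B^{opt})+E[\xi_01(0,1\in B^{opt})].$$ **Proposition.** The stationary quintuple process (with $A^{opt},B^{opt}$) exists, and for every such process, a.s. and in $L^1$, $$\lim_{n\to\infty}n^{-1}|B_n^{opt}\triangle A_n^{opt}|=\delta(\theta),\qquad \lim_{n\to\infty}n^{-1}\bigl(M_n-f_n(B_n^{opt})\bigr)=\varepsilon(\theta)$$ (so $\delta(\theta)$ and $\varepsilon(\theta)$ do not depend on the version of the process). Moreover, for any random sets $B'_n\subseteq\{1,\dots,n\}$ such that $n^{-1}|B'_n\triangle A_n^{opt}|\to\delta(\theta)$ in $L^1$, $$\liminf_{n\to\infty}n^{-1}E\bigl(M_n-f_n(B'_n)\bigr)\ \ge\ \varepsilon(\theta),$$ the expectation of the nonnegative variable $M_n-f_n(B'_n)$ being taken in $[0,\infty]$. -/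

import Mathlib

open MeasureTheory ProbabilityTheory Filter Topology

universe u v

/-! ### The finite optimization problems -/

/-- The benefit `f_n(S) = |S| - ∑_{i=1}^{n-1} x_i 1(i ∈ S, i+1 ∈ S)` of a set `S ⊆ {1,…,n}`. -/
def benefit (n : ℕ) (x : ℕ → ℝ) (S : Finset ℕ) : ℝ :=
  (S.card : ℝ) - ∑ i ∈ Finset.Ico 1 n, if i ∈ S ∧ i + 1 ∈ S then x i else 0

/-- `M_n = max_{S ⊆ {1,…,n}} f_n(S)`. -/
noncomputable def maxBenefit (n : ℕ) (x : ℕ → ℝ) : ℝ :=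
  (Finset.Icc 1 n).powerset.sup' (Finset.powerset_nonempty _) (benefit n x)

/-- `S` attains the maximum in the definition of `M_n`. -/
def IsOptimal (n : ℕ) (x : ℕ → ℝ) (S : Finset ℕ) : Prop :=
  S ⊆ Finset.Icc 1 n ∧ ∀ T ⊆ Finset.Icc 1 n, benefit n x T ≤ benefit n x S

/-- The modified objective `f_n(S) + θ |S △ A|`. -/
def modifiedBenefit (n : ℕ) (x : ℕ → ℝ) (θ : ℝ) (A S : Finset ℕ) : ℝ :=
  benefit n x S + θ * ((symmDiff S A).card : ℝ)

/-- `S ⊆ {1,…,n}` maximizes `f_n(S) + θ |S △ A|`. -/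
def IsModifiedOptimal (n : ℕ) (x : ℕ → ℝ) (θ : ℝ) (A S : Finset ℕ) : Prop :=
  S ⊆ Finset.Icc 1 n ∧
    ∀ T ⊆ Finset.Icc 1 n, modifiedBenefit n x θ A T ≤ modifiedBenefit n x θ A S

/-- Among all maximizers of the modified objective, `S` is the one preferred by the tie-breaking
rule: the smallest item on which `S` differs from another maximizer belongs to `S`. -/
def IsPreferred (n : ℕ) (x : ℕ → ℝ) (θ : ℝ) (A S : Finset ℕ) : Prop :=
  ∀ T, IsModifiedOptimal n x θ A T → ∀ i ∈ T \ S, ∃ j ∈ S \ T, j < i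

/-! ### The cost distribution -/

/-- `ν` is the law of a strictly positive random variable with a density that is bounded and
continuous on `(0,∞)` and positive at `1/2`. -/
def IsCostLaw (ν : Measure ℝ) : Prop :=
  IsProbabilityMeasure ν ∧ ∃ g : ℝ → ℝ,
    (∀ t ∈ Set.Ioi (0 : ℝ), 0 ≤ g t) ∧
    (∃ C : ℝ, ∀ t ∈ Set.Ioi (0 : ℝ), g t ≤ C) ∧
    ContinuousOn g (Set.Ioi 0) ∧
    0 < g (1 / 2) ∧
    ν = (volume.restrict (Set.Ioi 0)).withDensity (fun t => ENNReal.ofReal (g t))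

/-! ### The infinite limit problem -/

open Classical in
/-- `J_i = 1(i ∉ A) - 1(i ∈ A)`. -/
noncomputable def signJ (A : Set ℤ) (i : ℤ) : ℝ := if i ∈ A then -1 else 1

open Classical in
/-- The benefit, relative to excluding both items `i` and `i + 1`, of including item `i` iff `p` and
item `i + 1` iff `q`.  The four values are `zL + zR - x`, `zL`, `zR` and `0`. -/
noncomputable def relBenefit (zL x zR : ℝ) (p q : Prop) : ℝ :=
  (if p then zL else 0) + (if q then zR else 0) - (if p ∧ q then x else 0)

/-- The stationary quintuple process `(Z^L_i, X^L_i, ξ_i, X^R_{i+1}, Z^R_{i+1})`, `i ∈ ℤ`, for the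
cost law `ν` and the multiplier `θ`, with the random sets `A`, `B ⊆ ℤ` which it determines. -/
structure StationaryQuintuple (ν : Measure ℝ) (θ : ℝ) where
  Ω : Type u
  [mΩ : MeasurableSpace Ω]
  P : Measure Ω
  [isProb : IsProbabilityMeasure P]
  ZL : ℤ → Ω → ℝ
  XL : ℤ → Ω → ℝ
  ξ : ℤ → Ω → ℝ
  XR : ℤ → Ω → ℝ
  ZR : ℤ → Ω → ℝ
  A : Ω → Set ℤ
  B : Ω → Set ℤ
  measurable_ZL : ∀ i, Measurable (ZL i)
  measurable_XL : ∀ i, Measurable (XL i)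
  measurable_ξ : ∀ i, Measurable (ξ i)
  measurable_XR : ∀ i, Measurable (XR i)
  measurable_ZR : ∀ i, Measurable (ZR i)
  measurable_A : ∀ i, MeasurableSet {ω | i ∈ A ω}
  measurable_B : ∀ i, MeasurableSet {ω | i ∈ B ω}
  /-- the process is stationary -/
  stationary :
    P.map (fun ω (i : ℤ) => (ZL i ω, XL i ω, ξ i ω, XR (i + 1) ω, ZR (i + 1) ω)) =
    P.map (fun ω (i : ℤ) =>
      (ZL (i + 1) ω, XL (i + 1) ω, ξ (i + 1) ω, XR (i + 1 + 1) ω, ZR (i + 1 + 1) ω))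
  /-- the costs are i.i.d. with law `ν` -/
  indep_ξ : iIndepFun ξ P
  law_ξ : ∀ i, P.map (ξ i) = ν
  XL_rec : ∀ᵐ ω ∂P, ∀ i, XL (i + 1) ω = max (1 - XL i ω) (1 - ξ i ω)
  XR_rec : ∀ᵐ ω ∂P, ∀ i, XR i ω = max (1 - XR (i + 1) ω) (1 - ξ i ω)
  /-- the inclusion criteria for `A` -/
  A_rule : ∀ᵐ ω ∂P, ∀ i,
    (ξ i ω < min (XL i ω) (XR (i + 1) ω) → i ∈ A ω ∧ i + 1 ∈ A ω) ∧
    (XR (i + 1) ω < min (XL i ω) (ξ i ω) → i ∈ A ω ∧ i + 1 ∉ A ω) ∧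
    (XL i ω < min (XR (i + 1) ω) (ξ i ω) → i ∉ A ω ∧ i + 1 ∈ A ω)
  ZL_rec : ∀ᵐ ω ∂P, ∀ i, ZL (i + 1) ω =
    1 - (if 0 < ZL i ω then min (ZL i ω) (ξ i ω) else 0) + θ * signJ (A ω) (i + 1)
  ZR_rec : ∀ᵐ ω ∂P, ∀ i, ZR i ω =
    1 - (if 0 < ZR (i + 1) ω then min (ZR (i + 1) ω) (ξ i ω) else 0) + θ * signJ (A ω) i
  /-- for each pair `(i, i+1)`, `B` uses a choice with the largest relative benefit -/
  B_max : ∀ᵐ ω ∂P, ∀ i, ∀ p q : Prop,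
    relBenefit (ZL i ω) (ξ i ω) (ZR (i + 1) ω) p q ≤
      relBenefit (ZL i ω) (ξ i ω) (ZR (i + 1) ω) (i ∈ B ω) (i + 1 ∈ B ω)
  /-- ties: given the decision at `i`, item `i + 1` is excluded only if that is strictly better -/
  B_tie : ∀ᵐ ω ∂P, ∀ i, i + 1 ∉ B ω →
    relBenefit (ZL i ω) (ξ i ω) (ZR (i + 1) ω) (i ∈ B ω) True <
      relBenefit (ZL i ω) (ξ i ω) (ZR (i + 1) ω) (i ∈ B ω) False

namespace StationaryQuintuple

variable {ν : Measure ℝ} {θ : ℝ}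

/-- `δ(θ) = P({0 ∈ A} △ {0 ∈ B})`. -/
noncomputable def delta (Q : StationaryQuintuple.{u} ν θ) : ℝ :=
  letI := Q.mΩ
  Q.P.real (symmDiff {ω | (0 : ℤ) ∈ Q.A ω} {ω | (0 : ℤ) ∈ Q.B ω})

/-- `P(0 ∈ S) - E[ξ_0 1(0 ∈ S, 1 ∈ S)]`, the mean benefit per item of a random set `S ⊆ ℤ`. -/
noncomputable def meanBenefit (Q : StationaryQuintuple.{u} ν θ) (S : Q.Ω → Set ℤ) : ℝ :=
  letI := Q.mΩ
  Q.P.real {ω | (0 : ℤ) ∈ S ω} -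
    ∫ ω, Set.indicator {ω | (0 : ℤ) ∈ S ω ∧ (1 : ℤ) ∈ S ω} (Q.ξ 0) ω ∂Q.P

/-- `ε(θ)`, the difference in mean benefit per item between `A` and `B`. -/
noncomputable def epsilon (Q : StationaryQuintuple.{u} ν θ) : ℝ :=
  Q.meanBenefit Q.A - Q.meanBenefit Q.B

end StationaryQuintuple

/-! ### Modes of convergence -/

/-- `Y_n → c` in `L¹`. -/
def ConvergesL1 {Ω : Type*} [MeasurableSpace Ω] (P : Measure Ω) (Y : ℕ → Ω → ℝ) (c : ℝ) : Prop :=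
  Tendsto (fun n => eLpNorm (fun ω => Y n ω - c) 1 P) atTop (𝓝 0)

/-- `Y_n → c` almost surely. -/
def ConvergesAS {Ω : Type*} [MeasurableSpace Ω] (P : Measure Ω) (Y : ℕ → Ω → ℝ) (c : ℝ) : Prop :=
  ∀ᵐ ω ∂P, Tendsto (fun n => Y n ω) atTop (𝓝 c)

/-! ### Local systems -/

/-! The selection problem is a one-dimensional dynamic program whose memory is erased wherever two
consecutive costs are small. Put c = 1/2 - τ, so that c + θ < 1/2, and call a pair of consecutive
costs at most c a run. At a run the backward value X^R is 1 minus the first cost of the pair,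
whatever lies to the right; Z^R is the same up to ±θ, with the sign given by A. Moreover the item
between the two cheap costs belongs to A and to B, whatever was decided before it. Between two runs
the decisions are therefore determined by the costs nearby; this is `IsLocalSystem.agree`. Since
G(c) > 0, runs have positive density.

Finite problem: up to a constant, θ|B △ A| changes the weight of item i from 1 to 1 + θ J_i. By
`regret_identity` the value of a set is a constant minus a sum of nonnegative regrets, so a set is
optimal exactly when no single decision incurs a regret. This turns global optimality into the local
rules of `IsLocalSystem`. Ties are the delicate point. Almost surely no two costs satisfy a relation
± x_i ± x_j ∈ ℤ + θℤ, and then a vanishing Z_i must have the form kθ with k = 0, or 1 + kθ with k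
odd. The second case makes 1/θ an odd integer, where the tie-breaking rule selects the greedy
maximizer. In the first case the derivative of Z_i in θ vanishes too, so all maximizers are equally
far from A, and B may be replaced by the greedy maximizer.

Limit problem: since runs reset the recursions, each has a solution obtained by starting it ever
further away. These solutions are measurable shift-equivariant functions of the i.i.d. costs, which
gives existence of the quintuple. Conversely, every quintuple is a local system, so its decisions
agree with the canonical ones between runs, and expectations of local functionals depend on ν and θ
only.

Convergence: distance and loss are, up to a bounded boundary error, sums of bounded local terms.
Such a term is a function of a window of fixed length unless the window lacks a run on one side,
which is rare for long windows. The law of large numbers for window functions gives almost sure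
convergence, and boundedness gives L¹. No moment of the cost law is needed, because a cost paid by A
is at most 1 and one paid by the greedy maximizer at most 1 + θ.

The lower bound for competing sets is weak Lagrangian duality: B maximizes f_n + θ|· △ A|, and the
two distance terms cancel in the limit. -/

open Classical in
/-- The cost of including item `i + 1`, given the decision `S` at `i`. -/
noncomputable def stepCost (x : ℤ → ℝ) (S : Set ℤ) (i : ℤ) : ℝ := if i ∈ S then x i else 0

/-- The right-hand recursions together with the left-to-right decision rules, for the pairs
`(i, i + 1)` with `a ≤ i < b`. -/
structure IsLocalSystem (θ : ℝ) (x XR ZR : ℤ → ℝ) (A B : Set ℤ) (a b : ℤ) : Prop where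
  XR_rec : ∀ i, a ≤ i → i < b → XR i = max (1 - XR (i + 1)) (1 - x i)
  A_mem : ∀ i, a ≤ i → i < b → stepCost x A i < XR (i + 1) → i + 1 ∈ A
  A_notMem : ∀ i, a ≤ i → i < b → XR (i + 1) < stepCost x A i → i + 1 ∉ A
  ZR_rec : ∀ i, a ≤ i → i < b →
    ZR i = 1 - (if 0 < ZR (i + 1) then min (ZR (i + 1)) (x i) else 0) + θ * signJ A i
  B_iff : ∀ i, a ≤ i → i < b → (i + 1 ∈ B ↔ stepCost x B i ≤ ZR (i + 1))

/-- The costs indexed by `I` are positive, and distinct ones satisfy no relation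
`± x_i ± x_j ∈ ℤ + θ ℤ`. -/
structure IsGenericOn {ι : Type*} (θ : ℝ) (x : ι → ℝ) (I : Set ι) : Prop where
  pos : ∀ i ∈ I, 0 < x i
  ne_const : ∀ i ∈ I, ∀ p q : ℤ, x i ≠ p + q * θ
  ne_add : ∀ i ∈ I, ∀ j ∈ I, i ≠ j → ∀ p q : ℤ, x i ≠ p + q * θ + x j
  ne_sub : ∀ i ∈ I, ∀ j ∈ I, i ≠ j → ∀ p q : ℤ, x i ≠ p + q * θ - x j

/-- Two consecutive costs, at `s` and `s + 1`, are at most `c`. -/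
def IsRun (c : ℝ) (x : ℤ → ℝ) (s : ℤ) : Prop := x s ≤ c ∧ x (s + 1) ≤ c

theorem signJ_ge (A : Set ℤ) (i : ℤ) : -1 ≤ signJ A i := by
  unfold signJ; split_ifs <;> norm_num

theorem signJ_le (A : Set ℤ) (i : ℤ) : signJ A i ≤ 1 := by
  unfold signJ; split_ifs <;> norm_num

theorem signJ_congr {A A' : Set ℤ} {i : ℤ} (h : i ∈ A ↔ i ∈ A') : signJ A i = signJ A' i := by
  by_cases h1 : i ∈ A
  · simp [signJ, h1, h.1 h1]
  · simp [signJ, h1, mt h.2 h1]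

theorem stepCost_congr {x x' : ℤ → ℝ} {A A' : Set ℤ} {i : ℤ} (hx : x i = x' i)
    (h : i ∈ A ↔ i ∈ A') : stepCost x A i = stepCost x' A' i := by
  by_cases h1 : i ∈ A
  · simp [stepCost, h1, h.1 h1, hx]
  · simp [stepCost, h1, mt h.2 h1]

theorem stepCost_le {x : ℤ → ℝ} {S : Set ℤ} {i : ℤ} {c : ℝ} (hc : 0 ≤ c) (h : x i ≤ c) :
    stepCost x S i ≤ c := by
  unfold stepCost; split_ifs <;> assumption

theorem neg_mul_signJ_le {θ : ℝ} (hθ : 0 < θ) (A : Set ℤ) (i : ℤ) : -θ ≤ θ * signJ A i := by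
  nlinarith [signJ_ge A i]

theorem mul_signJ_le {θ : ℝ} (hθ : 0 < θ) (A : Set ℤ) (i : ℤ) : θ * signJ A i ≤ θ := by
  nlinarith [signJ_le A i]

theorem IsGenericOn.mono {ι : Type*} {θ : ℝ} {x : ι → ℝ} {I K : Set ι} (h : IsGenericOn θ x I)
    (hK : K ⊆ I) : IsGenericOn θ x K :=
  ⟨fun i hi => h.pos i (hK hi), fun i hi => h.ne_const i (hK hi),
    fun i hi j hj => h.ne_add i (hK hi) j (hK hj), fun i hi j hj => h.ne_sub i (hK hi) j (hK hj)⟩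

theorem IsGenericOn.congr {ι : Type*} {θ : ℝ} {x x' : ι → ℝ} {I : Set ι} (h : IsGenericOn θ x I)
    (hx : ∀ i ∈ I, x i = x' i) : IsGenericOn θ x' I := by
  refine ⟨fun i hi => ?_, fun i hi => ?_, fun i hi j hj => ?_, fun i hi j hj => ?_⟩
  · rw [← hx i hi]; exact h.pos i hi
  · rw [← hx i hi]; exact h.ne_const i hi
  · rw [← hx i hi, ← hx j hj]; exact h.ne_add i hi j hj
  · rw [← hx i hi, ← hx j hj]; exact h.ne_sub i hi j hj

theorem IsGenericOn.comp {ι κ : Type*} {θ : ℝ} {x : ι → ℝ} {I : Set ι} {f : κ → ι} {K : Set κ}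
    (h : IsGenericOn θ x I) (hf : Set.MapsTo f K I) (hinj : Set.InjOn f K) :
    IsGenericOn θ (fun k => x (f k)) K :=
  ⟨fun _ hi => h.pos _ (hf hi), fun _ hi => h.ne_const _ (hf hi),
    fun _ hi _ hj hij => h.ne_add _ (hf hi) _ (hf hj) fun e => hij (hinj hi hj e),
    fun _ hi _ hj hij => h.ne_sub _ (hf hi) _ (hf hj) fun e => hij (hinj hi hj e)⟩

theorem IsLocalSystem.mono {θ : ℝ} {x XR ZR : ℤ → ℝ} {A B : Set ℤ} {a b a' b' : ℤ}
    (h : IsLocalSystem θ x XR ZR A B a b) (ha : a ≤ a') (hb : b' ≤ b) :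
    IsLocalSystem θ x XR ZR A B a' b' :=
  ⟨fun i h1 h2 => h.XR_rec i (ha.trans h1) (h2.trans_le hb),
    fun i h1 h2 => h.A_mem i (ha.trans h1) (h2.trans_le hb),
    fun i h1 h2 => h.A_notMem i (ha.trans h1) (h2.trans_le hb),
    fun i h1 h2 => h.ZR_rec i (ha.trans h1) (h2.trans_le hb),
    fun i h1 h2 => h.B_iff i (ha.trans h1) (h2.trans_le hb)⟩

theorem IsLocalSystem.shift {θ : ℝ} {x XR ZR : ℤ → ℝ} {A B : Set ℤ} {a b : ℤ} (k : ℤ)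
    (h : IsLocalSystem θ x XR ZR A B (a + k) (b + k)) :
    IsLocalSystem θ (fun i => x (i + k)) (fun i => XR (i + k)) (fun i => ZR (i + k))
      {i | i + k ∈ A} {i | i + k ∈ B} a b := by
  have e : ∀ i : ℤ, i + 1 + k = i + k + 1 := fun i => by ring
  refine ⟨fun i h1 h2 => ?_, fun i h1 h2 => ?_, fun i h1 h2 => ?_, fun i h1 h2 => ?_,
    fun i h1 h2 => ?_⟩
  · simpa only [e] using h.XR_rec (i + k) (by lia) (by lia)
  · rw [Set.mem_ofPred_eq, e]; exact h.A_mem (i + k) (by lia) (by lia)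
  · rw [Set.mem_ofPred_eq, e]; exact h.A_notMem (i + k) (by lia) (by lia)
  · rw [e]; exact h.ZR_rec (i + k) (by lia) (by lia)
  · rw [Set.mem_ofPred_eq, e]; exact h.B_iff (i + k) (by lia) (by lia)

/-! ### Runs decouple the two sides -/

theorem one_sub_min_form {p q : ℝ} : max (1 - p) (1 - q) = 1 - min p q := by
  rcases le_total p q with h | h
  · rw [min_eq_left h, max_eq_left (by linarith)]
  · rw [min_eq_right h, max_eq_right (by linarith)]

/-- The second cheap cost gives `1 - XR (t + 1) ≤ c`, and the first gives `1 - x t ≥ 1 - c > c`.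
Hence nothing to the right of the run influences the value at `t`. -/
theorem backward_at_run {c : ℝ} (hc : c < 1 / 2) {x XR : ℤ → ℝ} {t : ℤ}
    (h0 : XR t = max (1 - XR (t + 1)) (1 - x t))
    (h1 : XR (t + 1) = max (1 - XR (t + 1 + 1)) (1 - x (t + 1)))
    (hr : IsRun c x t) : XR t = 1 - x t := by
  have := le_max_right (1 - XR (t + 1 + 1)) (1 - x (t + 1))
  rw [h0]
  exact max_eq_right (by linarith [hr.1, hr.2])

/-- The subtracted term is at most `c` and the perturbation at least `-θ`, so the value is at least
`1 - c - θ > 1/2 > c`. This is where the size restriction on `θ` enters. -/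
theorem modified_gt {θ c : ℝ} (hθ : 0 < θ) (hc : c + θ < 1 / 2) {z y J : ℝ} (hy : y ≤ c)
    (hJ : -θ ≤ θ * J) {w : ℝ} (h : w = 1 - (if 0 < z then min z y else 0) + θ * J) (hc0 : 0 ≤ c) :
    c < w := by
  split_ifs at h
  · have := min_le_right z y
    linarith
  · linarith

/-- The analogue of `backward_at_run` for `ZR`: the far right is forgotten, but the decision of `A`
at `t` still enters. -/
theorem modified_at_run {θ c : ℝ} (hθ : 0 < θ) (hc : c + θ < 1 / 2) (hc0 : 0 ≤ c)
    {x ZR : ℤ → ℝ} {A : Set ℤ} {t : ℤ}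
    (h0 : ZR t = 1 - (if 0 < ZR (t + 1) then min (ZR (t + 1)) (x t) else 0) + θ * signJ A t)
    (h1 : ZR (t + 1) = 1 - (if 0 < ZR (t + 1 + 1) then min (ZR (t + 1 + 1)) (x (t + 1)) else 0)
      + θ * signJ A (t + 1))
    (hr : IsRun c x t) : ZR t = 1 - x t + θ * signJ A t := by
  have h2 := modified_gt hθ hc hr.2 (neg_mul_signJ_le hθ A (t + 1)) h1 hc0
  rw [h0, if_pos (by linarith), min_eq_right (by linarith [hr.1])]

/-- To the left of a run, the values of the backward recursion are `x_j` or `1 - x_j`. -/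
theorem backward_form {c : ℝ} (hc : c < 1 / 2) {x XR : ℤ → ℝ} {a t : ℤ}
    (hrec : ∀ i, a ≤ i → i < t + 2 → XR i = max (1 - XR (i + 1)) (1 - x i))
    (hr : IsRun c x t) (hpos : ∀ i, a ≤ i → i < t + 2 → 0 < x i) {i : ℤ} (hi : a ≤ i)
    (hit : i ≤ t) :
    (∃ j, i ≤ j ∧ j ≤ t ∧ (XR i = x j ∨ XR i = 1 - x j)) ∧ 0 ≤ XR i ∧ XR i ≤ 1 := by
  have hc0 := (hpos t (by lia) (by lia)).trans_le hr.1
  revert hi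
  induction i, hit using Int.leInductionDown with
  | base =>
    intro hi
    have := backward_at_run hc (hrec t hi (by lia)) (hrec (t + 1) (by lia) (by lia)) hr
    have h1 := hpos t hi (by lia)
    have h2 := hr.1
    exact ⟨⟨t, le_rfl, le_rfl, Or.inr this⟩, by linarith, by linarith⟩
  | pred k hk ih =>
    intro hi
    obtain ⟨⟨j, hj1, hj2, hj⟩, h0, h1⟩ := ih (by lia)
    have hx := hpos (k - 1) hi (by lia)
    have h := hrec (k - 1) hi (by lia)
    rw [sub_add_cancel] at h
    refine ⟨?_, ?_, ?_⟩
    · rcases le_total (1 - x (k - 1)) (1 - XR k) with h' | h'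
      · rw [max_eq_left h'] at h
        refine ⟨j, by lia, hj2, ?_⟩
        rcases hj with hj | hj
        · right; rw [h, hj]
        · left; rw [h, hj]; ring
      · rw [max_eq_right h'] at h
        exact ⟨k - 1, le_rfl, by lia, Or.inr h⟩
    · rw [h]; exact le_max_of_le_left (by linarith)
    · rw [h]; exact max_le (by linarith) (by linarith)

theorem ne_of_form {θ : ℝ} {x : ℤ → ℝ} {I : Set ℤ} (hg : IsGenericOn θ x I) {i j : ℤ} (hi : i ∈ I)
    (hj : j ∈ I) (hij : i ≠ j) {r : ℝ} (hr : r = x j ∨ r = 1 - x j) : r ≠ x i := by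
  rintro rfl
  rcases hr with hr | hr
  · exact hg.ne_add i hi j hj hij 0 0 (by simpa using hr)
  · exact hg.ne_sub i hi j hj hij 1 0 (by simpa using hr)

theorem form_ne_zero {θ : ℝ} {x : ℤ → ℝ} {I : Set ℤ} (hg : IsGenericOn θ x I) {j : ℤ}
    (hj : j ∈ I) {r : ℝ} (hr : r = x j ∨ r = 1 - x j) : r ≠ 0 := by
  rintro rfl
  rcases hr with hr | hr
  · exact (hg.pos j hj).ne hr
  · exact hg.ne_const j hj 1 0 (by push_cast; linarith)

/-- The rules for `A` leave ties open. To the left of a run, `XR (i + 1)` is `x j` or `1 - x j` with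
`j > i`, and genericity keeps this away from both `x i` and `0`, so no tie occurs. -/
theorem IsLocalSystem.A_iff {θ c : ℝ} (hc : c < 1 / 2) {x XR ZR : ℤ → ℝ}
    {A B : Set ℤ} {a b t : ℤ} (h : IsLocalSystem θ x XR ZR A B a b)
    (hg : IsGenericOn θ x (Set.Ico a b)) (htb : t + 2 ≤ b) (hr : IsRun c x t) {i : ℤ}
    (hi : a ≤ i) (hit : i < t) : i + 1 ∈ A ↔ stepCost x A i < XR (i + 1) := by
  obtain ⟨⟨j, hj1, hj2, hj⟩, -, -⟩ := backward_form hc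
    (fun i h1 h2 => h.XR_rec i h1 (h2.trans_le htb)) hr
    (fun i h1 h2 => hg.pos i ⟨h1, h2.trans_le htb⟩) (i := i + 1) (by lia) (by lia)
  have hne : XR (i + 1) ≠ stepCost x A i := by
    unfold stepCost
    split_ifs
    · exact ne_of_form hg (i := i) (j := j) ⟨by lia, by lia⟩ ⟨by lia, by lia⟩ (by lia) hj
    · exact form_ne_zero hg (j := j) ⟨by lia, by lia⟩ hj
  rcases lt_or_gt_of_ne hne with h' | h'
  · exact iff_of_false (h.A_notMem i hi (by lia) h') (by linarith)
  · exact iff_of_true (h.A_mem i hi (by lia) h') h'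

/-- Two local systems with the same generic costs make the same decisions between two runs. -/
theorem IsLocalSystem.agree {θ c : ℝ} (hθ : 0 < θ) (hc : c + θ < 1 / 2)
    {x XR ZR x' XR' ZR' : ℤ → ℝ} {A B A' B' : Set ℤ} {a b s t : ℤ}
    (h : IsLocalSystem θ x XR ZR A B a b) (h' : IsLocalSystem θ x' XR' ZR' A' B' a b)
    (hx : ∀ i ∈ Set.Ico a b, x i = x' i) (hg : IsGenericOn θ x (Set.Ico a b))
    (has : a ≤ s) (hst : s + 1 ≤ t) (htb : t + 2 ≤ b) (hs : IsRun c x s) (ht : IsRun c x t)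
    {i : ℤ} (hsi : s + 1 ≤ i) (hit : i ≤ t) : (i ∈ A ↔ i ∈ A') ∧ (i ∈ B ↔ i ∈ B') := by
  have hc2 : c < 1 / 2 := by linarith
  have hc0 : 0 ≤ c := ((hg.pos s ⟨has, by lia⟩).trans_le hs.1).le
  have hg' := hg.congr hx
  have ht' : IsRun c x' t := by
    unfold IsRun; rw [← hx t ⟨by lia, by lia⟩, ← hx (t + 1) ⟨by lia, by lia⟩]; exact ht
  -- Four inductions in a forced order: `XR` leftwards from the right run, `A` rightwards from the
  -- left run, then `ZR` leftwards, which needs `A`, and finally `B` rightwards.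
  have hXR : ∀ i, i ≤ t → a ≤ i → XR i = XR' i := by
    intro i hi
    induction i, hi using Int.leInductionDown with
    | base =>
      intro hi
      rw [backward_at_run hc2 (h.XR_rec t hi (by lia)) (h.XR_rec (t + 1) (by lia) (by lia)) ht,
        backward_at_run hc2 (h'.XR_rec t hi (by lia)) (h'.XR_rec (t + 1) (by lia) (by lia)) ht',
        hx t ⟨hi, by lia⟩]
    | pred k hk ih =>
      intro hi
      rw [h.XR_rec (k - 1) hi (by lia), h'.XR_rec (k - 1) hi (by lia), sub_add_cancel,
        ih (by lia), hx (k - 1) ⟨hi, by lia⟩]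
  -- Both backward values at `s + 1` exceed `c`, while including `s + 1` costs at most `c` whatever
  -- the decision at `s`.
  have base : ∀ {x XR ZR : ℤ → ℝ} {A B : Set ℤ}, IsLocalSystem θ x XR ZR A B a b →
      x s ≤ c → x (s + 1) ≤ c → s + 1 ∈ A ∧ s + 1 ∈ B := by
    intro x XR ZR A B h hs0 hs1
    refine ⟨h.A_mem s has (by lia) ?_, (h.B_iff s has (by lia)).2 ?_⟩
    · have := le_max_right (1 - XR (s + 1 + 1)) (1 - x (s + 1))
      rw [← h.XR_rec (s + 1) (by lia) (by lia)] at this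
      linarith [stepCost_le (S := A) hc0 hs0]
    · have := modified_gt hθ hc hs1 (neg_mul_signJ_le hθ A (s + 1))
        (h.ZR_rec (s + 1) (by lia) (by lia)) hc0
      linarith [stepCost_le (S := B) hc0 hs0]
  have b1 := base h hs.1 hs.2
  have b2 := base h' (by rw [← hx s ⟨has, by lia⟩]; exact hs.1)
    (by rw [← hx (s + 1) ⟨by lia, by lia⟩]; exact hs.2)
  have hA : ∀ i, s + 1 ≤ i → i ≤ t → (i ∈ A ↔ i ∈ A') := by
    intro i hi
    induction i, hi using Int.leInduction with
    | base => intro _; exact iff_of_true b1.1 b2.1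
    | succ k hk ih =>
      intro hkt
      rw [h.A_iff hc2 hg htb ht (i := k) (by lia) (by lia),
        h'.A_iff hc2 hg' htb ht' (i := k) (by lia) (by lia),
        stepCost_congr (hx k ⟨by lia, by lia⟩) (ih (by lia)), hXR (k + 1) hkt (by lia)]
  have hZR : ∀ i, i ≤ t → s + 1 ≤ i → ZR i = ZR' i := by
    intro i hi
    induction i, hi using Int.leInductionDown with
    | base =>
      intro hi
      rw [modified_at_run hθ hc hc0 (h.ZR_rec t (by lia) (by lia))
          (h.ZR_rec (t + 1) (by lia) (by lia)) ht,
        modified_at_run hθ hc hc0 (h'.ZR_rec t (by lia) (by lia))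
          (h'.ZR_rec (t + 1) (by lia) (by lia)) ht',
        hx t ⟨by lia, by lia⟩, signJ_congr (hA t hi le_rfl)]
    | pred k hk ih =>
      intro hi
      rw [h.ZR_rec (k - 1) (by lia) (by lia), h'.ZR_rec (k - 1) (by lia) (by lia), sub_add_cancel,
        ih (by lia), hx (k - 1) ⟨by lia, by lia⟩, signJ_congr (hA (k - 1) hi (by lia))]
  have hB : ∀ i, s + 1 ≤ i → i ≤ t → (i ∈ B ↔ i ∈ B') := by
    intro i hi
    induction i, hi using Int.leInduction with
    | base => intro _; exact iff_of_true b1.2 b2.2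
    | succ k hk ih =>
      intro hkt
      rw [h.B_iff k (by lia) (by lia), h'.B_iff k (by lia) (by lia),
        stepCost_congr (hx k ⟨by lia, by lia⟩) (ih (by lia)), hZR (k + 1) hkt (by lia)]
  exact ⟨hA i hsi hit, hB i hsi hit⟩

/-- Costs between two items of `A` are at most `1`, and between two items of `B` at most
`1 + θ`. -/
theorem IsLocalSystem.cost_le {θ : ℝ} (hθ : 0 < θ) {x XR ZR : ℤ → ℝ}
    {A B : Set ℤ} {a b i : ℤ} (h : IsLocalSystem θ x XR ZR A B a b) (ha : a ≤ i) (hb : i + 1 < b)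
    (hpos : ∀ j, a ≤ j → j < b → 0 ≤ x j) (hXR : 0 ≤ XR (i + 1 + 1)) :
    (i ∈ A → i + 1 ∈ A → x i ≤ 1) ∧ (i ∈ B → i + 1 ∈ B → x i ≤ 1 + θ) := by
  have hx := hpos (i + 1) (by lia) hb
  refine ⟨fun h0 h1 => ?_, fun h0 h1 => ?_⟩
  · by_contra hlt
    refine h.A_notMem i ha (by lia) ?_ h1
    rw [stepCost, if_pos h0, h.XR_rec (i + 1) (by lia) hb]
    exact (max_le (by linarith) (by linarith)).trans_lt (not_le.1 hlt)
  · have h2 := (h.B_iff i ha (by lia)).1 h1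
    rw [stepCost, if_pos h0, h.ZR_rec (i + 1) (by lia) hb] at h2
    have := mul_signJ_le hθ A (i + 1)
    split_ifs at h2 with h3
    · have := le_min h3.le hx
      linarith
    · linarith

/-! ### Dynamic programming for the finite problem -/

/-- The benefit of `S ⊆ {1,…,n}` when item `i` has the weight `w i`. -/
noncomputable def weightedBenefit (n : ℕ) (x w : ℕ → ℝ) (S : Finset ℕ) : ℝ :=
  ∑ i ∈ S, w i - ∑ i ∈ Finset.Ico 1 n, if i ∈ S ∧ i + 1 ∈ S then x i else 0

/-- The cost of including item `i`, given the decision `S` at `i - 1`. -/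
noncomputable def prevCost (x : ℕ → ℝ) (S : Finset ℕ) (i : ℕ) : ℝ :=
  if i - 1 ∈ S then x (i - 1) else 0

theorem exists_backward (f : ℕ → ℝ → ℝ) (n : ℕ) :
    ∃ Z : ℕ → ℝ, Z (n + 1) = 0 ∧ ∀ i ≤ n, Z i = f i (Z (i + 1)) := by
  -- Reversed time: `aux k` is the value at `n + 1 - k`.
  let aux : ℕ → ℝ := fun k => Nat.rec 0 (fun k z => f (n - k) z) k
  refine ⟨fun i => aux (n + 1 - i), by simp [aux], fun i hi => ?_⟩
  have h1 : n + 1 - i = (n - i) + 1 := by lia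
  have h2 : n + 1 - (i + 1) = n - i := by lia
  have h3 : n - (n - i) = i := by lia
  simp only [h1, h2]
  change f (n - (n - i)) (aux (n - i)) = _
  rw [h3]

theorem sum_eq_sum_Icc {n : ℕ} {S : Finset ℕ} (hS : S ⊆ Finset.Icc 1 n) (w : ℕ → ℝ) :
    ∑ i ∈ S, w i = ∑ i ∈ Finset.Ico 1 (n + 1), if i ∈ S then w i else 0 := by
  rw [← Finset.sum_filter]
  refine Finset.sum_congr ?_ fun _ _ => rfl
  ext i
  simp only [Finset.mem_filter, Finset.mem_Ico]
  exact ⟨fun h => ⟨by have := Finset.mem_Icc.1 (hS h); lia, h⟩, fun h => h.2⟩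

/-- The value of a set is a constant minus the sum of the regrets of its decisions. -/
theorem regret_identity {n : ℕ} (hn : 1 ≤ n) (κ w Z g₀ g₁ : ℕ → ℝ)
    (hZ : ∀ i, 1 ≤ i → i ≤ n → Z i = w i + g₁ (i + 1) - g₀ (i + 1))
    (h0 : g₀ (n + 1) = 0) (h1 : g₁ (n + 1) = 0) {S : Finset ℕ} (hS : S ⊆ Finset.Icc 1 n) :
    weightedBenefit n κ w S = ∑ i ∈ Finset.Ico 1 (n + 1), g₀ i -
      ∑ i ∈ Finset.Ico 1 (n + 1), ((if i - 1 ∈ S then g₁ i else g₀ i) -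
        if i ∈ S then Z i - prevCost κ S i else 0) := by
  have h0S : 0 ∉ S := fun h => by simpa using Finset.mem_Icc.1 (hS h)
  -- Truncating at `m` leaves one correction term, the effect of the decision at `m` on the
  -- continuation; it vanishes at `m = n` by `h0` and `h1`. The continuation values `g₀` (previous
  -- item excluded) and `g₁` (included) stay abstract, since the identity is used both for the value
  -- and for its derivative in `θ`.
  have key : ∀ m, 1 ≤ m → m ≤ n →
      (∑ i ∈ Finset.Ico 1 (m + 1), if i ∈ S then w i else 0) -
        (∑ i ∈ Finset.Ico 1 m, if i ∈ S ∧ i + 1 ∈ S then κ i else 0) =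
      ∑ i ∈ Finset.Ico 1 (m + 1), g₀ i -
      ∑ i ∈ Finset.Ico 1 (m + 1), ((if i - 1 ∈ S then g₁ i else g₀ i) -
        if i ∈ S then Z i - prevCost κ S i else 0) -
      ((if m ∈ S then g₁ (m + 1) else g₀ (m + 1)) - g₀ (m + 1)) := by
    intro m hm
    induction m, hm using Nat.le_induction with
    | base =>
      intro h
      have := hZ 1 le_rfl h
      simp only [Nat.Ico_succ_singleton, Finset.sum_singleton, Finset.Ico_self, Finset.sum_empty,
        Nat.sub_self, h0S, if_false, prevCost]
      split_ifs <;> linarith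
    | succ m hm ih =>
      intro h
      have := hZ (m + 1) (by lia) h
      have ih := ih (by lia)
      simp only [Finset.sum_Ico_succ_top hm, Finset.sum_Ico_succ_top (show 1 ≤ m + 1 by lia),
        Nat.add_sub_cancel, prevCost] at ih ⊢
      by_cases ha : m ∈ S <;> by_cases hb : m + 1 ∈ S <;>
        simp only [ha, hb, and_self, and_false, false_and, if_true, if_false] at ih ⊢ <;> linarith
  have := key n hn le_rfl
  rw [weightedBenefit, sum_eq_sum_Icc hS, this, h0, h1]
  simp

/-- `Z` is the relative benefit of item `i` in the problem on `{i,…,n}` with weights `w`. -/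
structure IsBackwardValue (n : ℕ) (x w Z : ℕ → ℝ) : Prop where
  last : Z (n + 1) = 0
  step : ∀ i, 1 ≤ i → i ≤ n → Z i = w i - if 0 < Z (i + 1) then min (Z (i + 1)) (x i) else 0

theorem exists_isBackwardValue (n : ℕ) (x w : ℕ → ℝ) : ∃ Z, IsBackwardValue n x w Z := by
  obtain ⟨Z, h0, h⟩ := exists_backward (fun i z => w i - if 0 < z then min z (x i) else 0) n
  exact ⟨Z, h0, fun i _ hi => h i hi⟩

/-- The regret of the decision of `S` at item `i`. -/
noncomputable def regret (x Z : ℕ → ℝ) (S : Finset ℕ) (i : ℕ) : ℝ :=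
  max 0 (Z i - prevCost x S i) - if i ∈ S then Z i - prevCost x S i else 0

theorem regret_nonneg (x Z : ℕ → ℝ) (S : Finset ℕ) (i : ℕ) : 0 ≤ regret x Z S i := by
  unfold regret
  split_ifs
  · linarith [le_max_right 0 (Z i - prevCost x S i)]
  · linarith [le_max_left 0 (Z i - prevCost x S i)]

theorem regret_eq_zero_iff {x Z : ℕ → ℝ} {S : Finset ℕ} {i : ℕ} : regret x Z S i = 0 ↔
    (i ∈ S → prevCost x S i ≤ Z i) ∧ (i ∉ S → Z i ≤ prevCost x S i) := by
  unfold regret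
  by_cases h : i ∈ S
  · simp [h, sub_eq_zero]
  · simp [h]

/-- The continuation values are `max 0 Z` and `max 0 (Z - x)`; the recursion for `Z` fits
`regret_identity` because for `y ≥ 0` the difference `max 0 z - max 0 (z - y)` is `min z y` if `z >
0` and `0` otherwise. -/
theorem IsBackwardValue.value_eq {n : ℕ} (hn : 1 ≤ n) {x w Z : ℕ → ℝ}
    (hZ : IsBackwardValue n x w Z) (hx : ∀ i, 1 ≤ i → 0 ≤ x i) {S : Finset ℕ}
    (hS : S ⊆ Finset.Icc 1 n) :
    weightedBenefit n x w S = ∑ i ∈ Finset.Ico 1 (n + 1), max 0 (Z i) -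
      ∑ i ∈ Finset.Ico 1 (n + 1), regret x Z S i := by
  have := regret_identity hn x w Z (fun i => max 0 (Z i)) (fun i => max 0 (Z i - x (i - 1)))
    (fun i h1 h2 => ?_) (by simp [hZ.last]) (by simp [hZ.last, hx n hn]) hS
  · rw [this]
    congr 1
    refine Finset.sum_congr rfl fun i _ => ?_
    unfold regret prevCost
    by_cases h : i - 1 ∈ S <;> simp [h]
  · have h0 := hx i h1
    rw [hZ.step i h1 h2, Nat.add_sub_cancel]
    generalize Z (i + 1) = z
    split_ifs with h
    · rw [max_eq_right h.le]
      rcases le_total z (x i) with h' | h'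
      · rw [min_eq_left h', max_eq_left (by linarith)]; ring
      · rw [min_eq_right h', max_eq_right (by linarith)]; ring
    · rw [max_eq_left (not_lt.1 h), max_eq_left (by linarith)]; ring

/-- The decisions which never incur a regret and resolve ties by inclusion. -/
def greedy (x Z : ℕ → ℝ) : ℕ → Prop
  | 0 => False
  | i + 1 => (greedy x Z i ∧ x i ≤ Z (i + 1)) ∨ (¬ greedy x Z i ∧ 0 ≤ Z (i + 1))

open Classical in
/-- The subset of `{1,…,n}` of the greedy decisions. -/
noncomputable def greedySet (n : ℕ) (x Z : ℕ → ℝ) : Finset ℕ :=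
  (Finset.Icc 1 n).filter (greedy x Z)

theorem greedySet_subset (n : ℕ) (x Z : ℕ → ℝ) : greedySet n x Z ⊆ Finset.Icc 1 n := by
  classical exact Finset.filter_subset _ _

theorem mem_greedySet_iff {n : ℕ} {x Z : ℕ → ℝ} {i : ℕ} (h1 : 1 ≤ i) (hi : i ≤ n) :
    i ∈ greedySet n x Z ↔ prevCost x (greedySet n x Z) i ≤ Z i := by
  obtain ⟨j, rfl⟩ : ∃ j, i = j + 1 := ⟨i - 1, by lia⟩
  have hj : j ∈ greedySet n x Z ↔ greedy x Z j := by
    unfold greedySet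
    rcases Nat.eq_zero_or_pos j with rfl | hj
    · simp [greedy]
    · simp [show 1 ≤ j by lia, show j ≤ n by lia]
  have hj1 : j + 1 ∈ greedySet n x Z ↔ greedy x Z (j + 1) := by
    simp [greedySet, hi]
  rw [hj1, prevCost, Nat.add_sub_cancel, greedy]
  by_cases h : greedy x Z j <;> simp [hj, h]

theorem regret_greedySet {n : ℕ} {x Z : ℕ → ℝ} {i : ℕ} (h1 : 1 ≤ i) (hi : i ≤ n) :
    regret x Z (greedySet n x Z) i = 0 :=
  regret_eq_zero_iff.2 ⟨(mem_greedySet_iff h1 hi).1,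
    fun h => (not_le.1 (mt (mem_greedySet_iff h1 hi).2 h)).le⟩

theorem IsBackwardValue.greedySet_optimal {n : ℕ} (hn : 1 ≤ n) {x w Z : ℕ → ℝ}
    (hZ : IsBackwardValue n x w Z) (hx : ∀ i, 1 ≤ i → 0 ≤ x i) {T : Finset ℕ}
    (hT : T ⊆ Finset.Icc 1 n) :
    weightedBenefit n x w T ≤ weightedBenefit n x w (greedySet n x Z) := by
  rw [hZ.value_eq hn hx hT, hZ.value_eq hn hx (greedySet_subset n x Z),
    Finset.sum_eq_zero (s := Finset.Ico 1 (n + 1)) (f := regret x Z (greedySet n x Z))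
      fun i hi => regret_greedySet (by simp at hi; lia) (by simp at hi; lia)]
  have := Finset.sum_nonneg (s := Finset.Ico 1 (n + 1)) fun i _ => regret_nonneg x Z T i
  linarith

/-- An optimal set does as well as the greedy one, which has no regret. Its nonnegative regrets
therefore sum to zero and vanish one by one: optimality becomes a local condition. -/
theorem IsBackwardValue.regret_eq_zero {n : ℕ} (hn : 1 ≤ n) {x w Z : ℕ → ℝ}
    (hZ : IsBackwardValue n x w Z) (hx : ∀ i, 1 ≤ i → 0 ≤ x i) {S : Finset ℕ}
    (hS : S ⊆ Finset.Icc 1 n)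
    (hopt : ∀ T ⊆ Finset.Icc 1 n, weightedBenefit n x w T ≤ weightedBenefit n x w S) {i : ℕ}
    (h1 : 1 ≤ i) (hi : i ≤ n) : regret x Z S i = 0 := by
  have h := hopt _ (greedySet_subset n x Z)
  rw [hZ.value_eq hn hx hS, hZ.value_eq hn hx (greedySet_subset n x Z),
    Finset.sum_eq_zero (s := Finset.Ico 1 (n + 1)) (f := regret x Z (greedySet n x Z))
      fun i hi => regret_greedySet (by simp at hi; lia) (by simp at hi; lia)] at h
  have h0 : ∑ i ∈ Finset.Ico 1 (n + 1), regret x Z S i = 0 :=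
    le_antisymm (by linarith) (Finset.sum_nonneg fun i _ => regret_nonneg x Z S i)
  exact (Finset.sum_eq_zero_iff_of_nonneg fun i _ => regret_nonneg x Z S i).1 h0 i
    (by simp; lia)

/-! ### The modified objective as a weighted problem -/

/-- `J_i` for a finite set. -/
def finsetSign (A : Finset ℕ) (i : ℕ) : ℝ := if i ∈ A then -1 else 1

/-- Putting an item into `S` increases the distance by one if it is outside `A` and decreases it by
one otherwise. So the distance is an additive functional of `S` plus a constant, and the penalty
only changes the item weights. -/
theorem card_symmDiff_eq (A S : Finset ℕ) :
    ((symmDiff S A).card : ℝ) = ∑ i ∈ S, finsetSign A i + A.card := by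
  have h1 : (symmDiff S A).card = (S \ A).card + (A \ S).card := by
    rw [Finset.symmDiff_def, Finset.card_union_of_disjoint]
    exact disjoint_sdiff_sdiff
  have h2 := Finset.card_sdiff_add_card_inter A S
  have h3 : ∑ i ∈ S, finsetSign A i = ((S \ A).card : ℝ) - (A ∩ S).card := by
    unfold finsetSign
    rw [Finset.sum_ite, Finset.sum_const, Finset.sum_const, Finset.filter_mem_eq_inter,
      Finset.filter_notMem_eq_sdiff, Finset.inter_comm]
    simp; ring
  rw [h3, h1, ← h2]
  push_cast
  ring

theorem modifiedBenefit_eq (n : ℕ) (x : ℕ → ℝ) (θ : ℝ) (A S : Finset ℕ) :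
    modifiedBenefit n x θ A S =
      weightedBenefit n x (fun i => 1 + θ * finsetSign A i) S + θ * A.card := by
  rw [modifiedBenefit, benefit, weightedBenefit, card_symmDiff_eq, Finset.sum_add_distrib,
    ← Finset.mul_sum]
  simp
  ring

theorem benefit_eq (n : ℕ) (x : ℕ → ℝ) (S : Finset ℕ) :
    benefit n x S = weightedBenefit n x (fun _ => 1) S := by
  simp [benefit, weightedBenefit]

/-! ### Ties -/

/-- If `1 / θ` is not an odd integer, a relative benefit that vanishes has a vanishing derivative
with respect to `θ`. -/
theorem IsBackwardValue.exists_derivative {n : ℕ} {x Z : ℕ → ℝ} {θ : ℝ} {A : Finset ℕ}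
    (hZ : IsBackwardValue n x (fun i => 1 + θ * finsetSign A i) Z)
    (hg : IsGenericOn θ x (Set.Ici 1)) (hodd : ¬ ∃ k : ℕ, θ * (2 * (k : ℝ) + 1) = 1)
    (hθ : 0 < θ) :
    ∃ D : ℕ → ℝ, D (n + 1) = 0 ∧
      (∀ i, 1 ≤ i → i ≤ n → D i = finsetSign A i + (if x i < Z (i + 1) then D (i + 1) else 0) -
        if 0 < Z (i + 1) then D (i + 1) else 0) ∧
      (∀ i, 1 ≤ i → i ≤ n → Z i = 0 → D i = 0) ∧ ∀ i, 1 ≤ i → i < n → Z (i + 1) ≠ x i := by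
  obtain ⟨D, hD0, hD⟩ := exists_backward (fun i d => finsetSign A i +
    (if x i < Z (i + 1) then d else 0) - if 0 < Z (i + 1) then d else 0) n
  -- Either the value involves a later or present cost, and genericity forbids it to vanish or to
  -- equal an earlier cost, or it is affine in `θ` with integer slope `D i`; then an odd slope goes
  -- with constant term `1` and an even slope with `0`.
  have key : ∀ i ≤ n + 1, 1 ≤ i →
      (∃ j, i ≤ j ∧ ∃ p q : ℤ, Z i = p + q * θ + x j ∨ Z i = p + q * θ - x j) ∨
      ∃ k : ℤ, D i = k ∧ ((Odd k ∧ Z i = 1 + k * θ) ∨ (Even k ∧ Z i = k * θ)) := by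
    intro i hi
    induction hi using Nat.decreasingInduction with
    | self => exact fun _ => Or.inr ⟨0, by simpa using hD0, Or.inr ⟨by simp, by simpa using hZ.last⟩⟩
    | of_succ i hi ih =>
      intro h1
      have ih := ih (by lia)
      have hi' : i ≤ n := by lia
      have hzi := hZ.step i h1 hi'
      have hdi := hD i hi'
      obtain ⟨σ, hσ, hσo⟩ : ∃ σ : ℤ, finsetSign A i = σ ∧ Odd σ := by
        unfold finsetSign
        split_ifs
        · exact ⟨-1, by norm_num, by decide⟩
        · exact ⟨1, by norm_num, by decide⟩
      have hxi := hg.pos i h1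
      rw [hσ] at hzi hdi
      by_cases hz0 : 0 < Z (i + 1)
      · rw [if_pos hz0] at hzi hdi
        by_cases hzx : x i < Z (i + 1)
        · rw [min_eq_right hzx.le] at hzi
          exact Or.inl ⟨i, le_rfl, 1, σ, Or.inr (by rw [hzi]; push_cast; ring)⟩
        · rw [min_eq_left (not_lt.1 hzx)] at hzi
          rw [if_neg hzx] at hdi
          rcases ih with ⟨j, hj, p, q, h | h⟩ | ⟨k, hk, ⟨ho, h⟩ | ⟨he, h⟩⟩
          · exact Or.inl ⟨j, by lia, 1 - p, σ - q, Or.inr (by rw [hzi, h]; push_cast; ring)⟩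
          · exact Or.inl ⟨j, by lia, 1 - p, σ - q, Or.inl (by rw [hzi, h]; push_cast; ring)⟩
          · refine Or.inr ⟨σ - k, by rw [hdi, hk]; push_cast; ring, Or.inr ⟨hσo.sub_odd ho, ?_⟩⟩
            rw [hzi, h]; push_cast; ring
          · refine Or.inr ⟨σ - k, by rw [hdi, hk]; push_cast; ring, Or.inl ⟨hσo.sub_even he, ?_⟩⟩
            rw [hzi, h]; push_cast; ring
      · rw [if_neg hz0] at hzi hdi
        rw [if_neg (by linarith)] at hdi
        exact Or.inr ⟨σ, by rw [hdi]; ring, Or.inl ⟨hσo, by rw [hzi]; ring⟩⟩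
  refine ⟨D, hD0, fun i _ hi => hD i hi, fun i h1 hi hz => ?_, fun i h1 hi hz => ?_⟩
  · rcases key i (by lia) h1 with ⟨j, hj, p, q, h | h⟩ | ⟨k, hk, ⟨ho, h⟩ | ⟨he, h⟩⟩
    · refine (hg.ne_const j (show 1 ≤ j by lia) (-p) (-q) ?_).elim
      push_cast; linarith
    · refine (hg.ne_const j (show 1 ≤ j by lia) p q ?_).elim
      linarith
    · exfalso
      have hneg : k < 0 := by
        by_contra hk0
        have : (0 : ℝ) ≤ k := by exact_mod_cast not_lt.1 hk0
        nlinarith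
      obtain ⟨m, hm⟩ := ho
      -- With `k = 2 * m + 1 < 0`, the equation `1 + k * θ = 0` reads `θ * (2 * (-m - 1) + 1) = 1`.
      refine hodd ⟨(-m - 1).toNat, ?_⟩
      have : (((-m - 1).toNat : ℤ) : ℝ) = ((-m - 1 : ℤ) : ℝ) := by
        rw [Int.toNat_of_nonneg (by lia)]
      rw [Int.cast_natCast] at this
      rw [this]
      rw [hz, hm] at h
      push_cast at h ⊢
      linarith
    · rw [hz] at h
      rcases mul_eq_zero.1 h.symm with h | h
      · rw [hk, h]
      · exact absurd h hθ.ne'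
  · rcases key (i + 1) (by lia) (by lia) with ⟨j, hj, p, q, h | h⟩ | ⟨k, hk, ⟨ho, h⟩ | ⟨he, h⟩⟩
    · exact hg.ne_add i h1 j (show 1 ≤ j by lia) (by lia) p q (by rw [← hz, h])
    · exact hg.ne_sub i h1 j (show 1 ≤ j by lia) (by lia) p q (by rw [← hz, h])
    · exact hg.ne_const i h1 1 k (by rw [← hz, h]; push_cast; ring)
    · exact hg.ne_const i h1 0 k (by rw [← hz, h]; push_cast; ring)

/-- If `1 / θ` is not an odd integer, all maximizers are equally far from `A`. -/
theorem IsBackwardValue.sum_finsetSign_eq {n : ℕ} (hn : 1 ≤ n) {x Z : ℕ → ℝ} {θ : ℝ}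
    {A : Finset ℕ} (hZ : IsBackwardValue n x (fun i => 1 + θ * finsetSign A i) Z)
    (hg : IsGenericOn θ x (Set.Ici 1)) (hodd : ¬ ∃ k : ℕ, θ * (2 * (k : ℝ) + 1) = 1)
    (hθ : 0 < θ) {S T : Finset ℕ} (hS : S ⊆ Finset.Icc 1 n) (hT : T ⊆ Finset.Icc 1 n)
    (hSr : ∀ i, 1 ≤ i → i ≤ n → regret x Z S i = 0)
    (hTr : ∀ i, 1 ≤ i → i ≤ n → regret x Z T i = 0) :
    ∑ i ∈ S, finsetSign A i = ∑ i ∈ T, finsetSign A i := by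
  obtain ⟨D, hD0, hD, hD1, hne⟩ := hZ.exists_derivative hg hodd hθ
  have key : ∀ S : Finset ℕ, S ⊆ Finset.Icc 1 n →
      (∀ i, 1 ≤ i → i ≤ n → regret x Z S i = 0) → ∑ i ∈ S, finsetSign A i =
        ∑ i ∈ Finset.Ico 1 (n + 1), if 0 < Z i then D i else 0 := by
    intro S hS hr
    -- The regret identity differentiated in `θ`: the costs disappear, the weights become the signs,
    -- and the branches are still selected by `Z`. Zero regrets make every term vanish. At a tie `Z
    -- i = 0` this uses `D i = 0`; ties with a cost are ruled out by `hne`.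
    have h := regret_identity hn (fun _ => 0) (finsetSign A) D (fun i => if 0 < Z i then D i else 0)
      (fun i => if x (i - 1) < Z i then D i else 0) (fun i h1 hi => by simpa using hD i h1 hi)
      (by simp [hD0]) (by simp [hD0]) hS
    have hw : weightedBenefit n (fun _ => 0) (finsetSign A) S = ∑ i ∈ S, finsetSign A i := by
      simp [weightedBenefit]
    rw [← hw, h, sub_eq_self]
    refine Finset.sum_eq_zero fun i hi => ?_
    have hi1 : 1 ≤ i ∧ i ≤ n := by simp at hi; lia
    have h2 := regret_eq_zero_iff.1 (hr i hi1.1 hi1.2)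
    have hp : prevCost (fun _ => (0 : ℝ)) S i = 0 := by simp [prevCost]
    rw [hp, sub_zero]
    unfold prevCost at h2
    by_cases hq : i - 1 ∈ S
    · rw [if_pos hq] at h2 ⊢
      have h1 := (Finset.mem_Icc.1 (hS hq)).1
      have hne' := hne (i - 1) h1 (by lia)
      rw [Nat.sub_add_cancel hi1.1] at hne'
      by_cases hiS : i ∈ S
      · rw [if_pos hiS, if_pos (lt_of_le_of_ne (h2.1 hiS) hne'.symm), sub_self]
      · rw [if_neg hiS, if_neg (not_lt.2 (h2.2 hiS)), sub_self]
    · rw [if_neg hq] at h2 ⊢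
      by_cases hiS : i ∈ S
      · rw [if_pos hiS]
        split_ifs with h0
        · simp
        · rw [hD1 i hi1.1 hi1.2 (le_antisymm (not_lt.1 h0) (h2.1 hiS)), sub_self]
      · rw [if_neg hiS, if_neg (not_lt.2 (h2.2 hiS)), sub_self]
  rw [key S hS hSr, key T hT hTr]

/-! ### The finite problem as a local system -/

theorem min_form_eq {z y : ℝ} (hz : 0 ≤ z) (hy : 0 < y) :
    1 - (if 0 < z then min z y else 0) = max (1 - z) (1 - y) := by
  rw [one_sub_min_form]
  split_ifs with h
  · rfl
  · rw [le_antisymm (not_lt.1 h) hz, min_eq_left hy.le]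

/-- The extension by `toNat` of a sequence to `ℤ`. -/
def extendInt {α : Type*} (f : ℕ → α) (k : ℤ) : α := f k.toNat

/-- The items of a finite set, as integers. -/
def intItems (S : Finset ℕ) : Set ℤ := {k | k.toNat ∈ S}

theorem mem_intItems {S : Finset ℕ} {k : ℤ} : k ∈ intItems S ↔ k.toNat ∈ S := Iff.rfl

/-- A maximizer `B` need not resolve ties as `IsLocalSystem` demands, so the system is built with
the greedy maximizer `B₁`. Equal distance comes from `sum_finsetSign_eq`, or from `B = B₁` when `1 /
θ` is an odd integer; equal benefit follows, as both maximize the same objective. -/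
theorem exists_isLocalSystem {n : ℕ} (hn : 1 ≤ n) {x : ℕ → ℝ} {θ : ℝ} (hθ : 0 < θ)
    (hg : IsGenericOn θ x (Set.Ici 1)) {A B : Finset ℕ} (hA : IsOptimal n x A)
    (hB : IsModifiedOptimal n x θ A B)
    (hpref : (∃ k : ℕ, θ * (2 * (k : ℝ) + 1) = 1) → IsPreferred n x θ A B) :
    ∃ (XR ZR : ℤ → ℝ) (B₁ : Finset ℕ), B₁ ⊆ Finset.Icc 1 n ∧
      IsLocalSystem θ (extendInt x) XR ZR (intItems A) (intItems B₁) 1 n ∧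
      (symmDiff B A).card = (symmDiff B₁ A).card ∧ benefit n x B = benefit n x B₁ ∧
      (∀ i, i ∈ A → i + 1 ∈ A → x i ≤ 1) ∧ ∀ i, i ∈ B₁ → i + 1 ∈ B₁ → x i ≤ 1 + θ := by
  have hx : ∀ i, 1 ≤ i → 0 ≤ x i := fun i hi => (hg.pos i hi).le
  obtain ⟨X, hX⟩ := exists_isBackwardValue n x (fun _ => 1)
  obtain ⟨Z, hZ⟩ := exists_isBackwardValue n x (fun i => 1 + θ * finsetSign A i)
  set B₁ := greedySet n x Z with hB₁
  have hsub : B₁ ⊆ Finset.Icc 1 n := greedySet_subset n x Z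
  have hXb : ∀ i ≤ n + 1, 1 ≤ i → 0 ≤ X i ∧ X i ≤ 1 := by
    intro i hi
    induction hi using Nat.decreasingInduction with
    | self => intro _; simp [hX.last]
    | of_succ i hi ih =>
      intro h1
      have ih := ih (by lia)
      have h0 := hg.pos i h1
      rw [hX.step i h1 (by lia), min_form_eq ih.1 h0]
      exact ⟨le_max_of_le_left (by linarith), max_le (by linarith) (by linarith)⟩
  have hAr : ∀ i, 1 ≤ i → i ≤ n → regret x X A i = 0 := fun i h1 hi =>
    hX.regret_eq_zero hn hx hA.1 (fun T hT => by simpa only [benefit_eq] using hA.2 T hT) h1 hi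
  have hmod : ∀ S, IsModifiedOptimal n x θ A S → ∀ i, 1 ≤ i → i ≤ n → regret x Z S i = 0 :=
    fun S hS i h1 hi => hZ.regret_eq_zero hn hx hS.1
      (fun T hT => by simpa only [modifiedBenefit_eq, add_le_add_iff_right] using hS.2 T hT) h1 hi
  have hB₁opt : IsModifiedOptimal n x θ A B₁ :=
    ⟨hsub, fun T hT => by
      simpa only [modifiedBenefit_eq, add_le_add_iff_right] using hZ.greedySet_optimal hn hx hT⟩
  have hval : modifiedBenefit n x θ A B = modifiedBenefit n x θ A B₁ :=
    le_antisymm (hB₁opt.2 _ hB.1) (hB.2 _ hsub)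
  have hcard : (symmDiff B A).card = (symmDiff B₁ A).card := by
    by_cases hodd : ∃ k : ℕ, θ * (2 * (k : ℝ) + 1) = 1
    -- Strong induction on the item. With equal earlier decisions, an item of `B` shows no regret
    -- and is taken by the greedy rule; an item of `B₁` missing from `B` would require an earlier
    -- disagreement by the preference rule.
    · suffices B = B₁ by rw [this]
      have hp := hpref hodd B₁ hB₁opt
      have key : ∀ i, i ∈ B ↔ i ∈ B₁ := by
        intro i
        induction i using Nat.strong_induction_on with
        | _ i ih =>
          constructor
          · intro h
            have h1 := Finset.mem_Icc.1 (hB.1 h)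
            refine (mem_greedySet_iff h1.1 h1.2).2 ?_
            have := (regret_eq_zero_iff.1 (hmod B hB i h1.1 h1.2)).1 h
            have e : prevCost x B₁ i = prevCost x B i := by
              unfold prevCost; simp only [ih (i - 1) (by lia)]
            rwa [← hB₁, e]
          · intro h
            by_contra hn
            obtain ⟨j, hj, hji⟩ := hp i (Finset.mem_sdiff.2 ⟨h, hn⟩)
            rw [Finset.mem_sdiff] at hj
            exact hj.2 ((ih j hji).1 hj.1)
      exact Finset.ext key
    · have := hZ.sum_finsetSign_eq hn hg hodd hθ hB.1 hsub (hmod B hB) (hmod B₁ hB₁opt)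
      have h2 := card_symmDiff_eq A B
      rw [this, ← card_symmDiff_eq] at h2
      exact_mod_cast h2
  have hcast : ∀ i : ℤ, 1 ≤ i → i < n → ∃ j : ℕ, i = j ∧ 1 ≤ j ∧ j < n := fun i h1 h2 =>
    ⟨i.toNat, by lia, by lia, by lia⟩
  have hstep : ∀ (S : Finset ℕ) (j : ℕ),
      stepCost (extendInt x) (intItems S) j = prevCost x S (j + 1) := by
    intro S j
    by_cases h : j ∈ S <;> simp [stepCost, prevCost, extendInt, mem_intItems, h]
  have htn : ∀ j : ℕ, ((j : ℤ) + 1).toNat = j + 1 := fun j => by lia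
  have hsign : ∀ j : ℕ, signJ (intItems A) j = finsetSign A j := by
    intro j
    by_cases h : j ∈ A <;> simp [signJ, finsetSign, mem_intItems, h]
  refine ⟨extendInt X, extendInt Z, B₁, hsub, ⟨?_, ?_, ?_, ?_, ?_⟩, hcard, ?_, ?_, ?_⟩
  · intro i h1 h2
    obtain ⟨j, rfl, h1, h2⟩ := hcast i h1 h2
    simp only [extendInt, htn, Int.toNat_natCast]
    rw [hX.step j h1 h2.le, min_form_eq (hXb (j + 1) (by lia) (by lia)).1 (hg.pos j h1)]
  · intro i h1 h2
    obtain ⟨j, rfl, h1, h2⟩ := hcast i h1 h2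
    rw [hstep, mem_intItems, extendInt, htn]
    intro h
    by_contra hn
    linarith [(regret_eq_zero_iff.1 (hAr (j + 1) (by lia) (by lia))).2 hn]
  · intro i h1 h2
    obtain ⟨j, rfl, h1, h2⟩ := hcast i h1 h2
    rw [hstep, mem_intItems, extendInt, htn]
    intro h hn
    linarith [(regret_eq_zero_iff.1 (hAr (j + 1) (by lia) (by lia))).1 hn]
  · intro i h1 h2
    obtain ⟨j, rfl, h1, h2⟩ := hcast i h1 h2
    simp only [extendInt, htn, Int.toNat_natCast, hsign]
    rw [hZ.step j h1 h2.le]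
    ring
  · intro i h1 h2
    obtain ⟨j, rfl, h1, h2⟩ := hcast i h1 h2
    rw [hstep, mem_intItems, extendInt, htn]
    exact mem_greedySet_iff (by lia) (by lia)
  · have := hval
    rw [modifiedBenefit, modifiedBenefit, hcard] at this
    linarith
  · intro i h0 h1
    have h2 := Finset.mem_Icc.1 (hA.1 h1)
    have h3 := (regret_eq_zero_iff.1 (hAr (i + 1) h2.1 h2.2)).1 h1
    rw [prevCost, Nat.add_sub_cancel, if_pos h0] at h3
    exact h3.trans (hXb (i + 1) (by lia) (by lia)).2
  · intro i h0 h1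
    have h2 := Finset.mem_Icc.1 (hsub h1)
    have h3 := (mem_greedySet_iff h2.1 h2.2).1 h1
    rw [← hB₁, prevCost, Nat.add_sub_cancel, if_pos h0, hZ.step (i + 1) h2.1 h2.2] at h3
    have h4 := hx (i + 1) (by lia)
    have h5 : θ * finsetSign A (i + 1) ≤ θ := by
      unfold finsetSign; split_ifs <;> linarith
    split_ifs at h3 with h6
    · have := le_min h6.le h4
      linarith
    · linarith

/-! ### Recursions on `ℤ` that forget their initial value -/

/-- The value at `i` of the recursion `U (k + 1) = T k (U k)` started from `0` at `i - m`. -/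
def iterFrom (T : ℤ → ℝ → ℝ) : ℕ → ℤ → ℝ
  | 0, _ => 0
  | m + 1, i => T (i - 1) (iterFrom T m (i - 1))

/-- The solution of the recursion `U (k + 1) = T k (U k)` started from `-∞`. -/
noncomputable def forwardSol (T : ℤ → ℝ → ℝ) (i : ℤ) : ℝ :=
  limsup (fun m => iterFrom T m i) atTop

/-- The solution of the recursion `U k = T k (U (k + 1))` started from `+∞`. -/
noncomputable def backwardSol (T : ℤ → ℝ → ℝ) (i : ℤ) : ℝ :=
  forwardSol (fun j => T (-j - 1)) (-i)

/-- Coupling from the past: the steps `s` and `s + 1` together form a constant map, so every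
iteration started at or before `s` has the same value at `s + 2` and from there on. -/
theorem eventually_iterFrom_eq {T : ℤ → ℝ → ℝ}
    (hT : ∀ i, ∃ s ≤ i, ∃ r, ∀ u, T (s + 1) (T s u) = r) (i : ℤ) :
    ∀ᶠ m in atTop, iterFrom T m i = forwardSol T i := by
  obtain ⟨s, hs, r, hr⟩ := hT (i - 2)
  have key : ∀ k : ℕ, ∃ r', ∀ m, k + 2 ≤ m → iterFrom T m (s + 2 + k) = r' := by
    intro k
    induction k with
    | zero =>
      refine ⟨r, fun m hm => ?_⟩
      obtain ⟨m, rfl⟩ := Nat.exists_eq_add_of_le' hm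
      rw [← hr (iterFrom T m s)]
      change T _ (T _ (iterFrom T m _)) = _
      have e1 : s + 2 + ((0 : ℕ) : ℤ) - 1 = s + 1 := by push_cast; ring
      have e2 : s + 1 - 1 = s := by ring
      rw [e1, e2]
    | succ k ih =>
      obtain ⟨r', hr'⟩ := ih
      refine ⟨T (s + 2 + k) r', fun m hm => ?_⟩
      obtain ⟨m, rfl⟩ := Nat.exists_eq_add_of_le' (show 1 ≤ m by lia)
      rw [← hr' m (by lia)]
      change T _ (iterFrom T m _) = _
      have e1 : s + 2 + ((k + 1 : ℕ) : ℤ) - 1 = s + 2 + k := by push_cast; ring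
      rw [e1]
  obtain ⟨r', hr'⟩ := key (i - 2 - s).toNat
  have e : s + 2 + ((i - 2 - s).toNat : ℤ) = i := by lia
  rw [e] at hr'
  have hev : ∀ᶠ m in atTop, iterFrom T m i = r' := eventually_atTop.2 ⟨_, hr'⟩
  have : forwardSol T i = r' := (tendsto_const_nhds.congr' (hev.mono fun _ h => h.symm)).limsup_eq
  rw [this]
  exact hev

theorem forwardSol_succ {T : ℤ → ℝ → ℝ}
    (hT : ∀ i, ∃ s ≤ i, ∃ r, ∀ u, T (s + 1) (T s u) = r) (i : ℤ) :
    forwardSol T (i + 1) = T i (forwardSol T i) := by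
  obtain ⟨m, h1, h2⟩ := ((eventually_iterFrom_eq hT i).and
    ((tendsto_add_atTop_nat 1).eventually (eventually_iterFrom_eq hT (i + 1)))).exists
  rw [← h2, ← h1, iterFrom, add_sub_cancel_right]

/-- The reflection `j ↦ -j - 1` of the steps turns the backward recursion into a forward one; a
resetting pair of steps at `s`, `s + 1` becomes the pair starting at `-s - 2`. -/
theorem backwardSol_eq {T : ℤ → ℝ → ℝ}
    (hT : ∀ i, ∃ s, i ≤ s ∧ ∃ r, ∀ u, T s (T (s + 1) u) = r) (i : ℤ) :
    backwardSol T i = T i (backwardSol T (i + 1)) := by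
  have h := forwardSol_succ (T := fun j => T (-j - 1)) (fun j => ?_) (-i - 1)
  · have e1 : -(-i - 1) - 1 = i := by ring
    have e2 : -i - 1 = -(i + 1) := by ring
    rwa [sub_add_cancel, e1, e2] at h
  · obtain ⟨s, hs, r, hr⟩ := hT (-j)
    refine ⟨-s - 2, by lia, r, fun u => ?_⟩
    have e1 : -(-s - 2 + 1) - 1 = s := by ring
    have e2 : -(-s - 2) - 1 = s + 1 := by ring
    simp only [e1, e2]
    exact hr u

theorem iterFrom_shift (T : ℤ → ℝ → ℝ) (k : ℤ) (m : ℕ) (i : ℤ) :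
    iterFrom (fun j => T (j + k)) m i = iterFrom T m (i + k) := by
  induction m generalizing i with
  | zero => rfl
  | succ m ih =>
    rw [iterFrom, iterFrom, ih]
    have e : i - 1 + k = i + k - 1 := by ring
    rw [e]

theorem forwardSol_shift (T : ℤ → ℝ → ℝ) (k i : ℤ) :
    forwardSol (fun j => T (j + k)) i = forwardSol T (i + k) := by
  simp only [forwardSol, iterFrom_shift]

theorem backwardSol_shift (T : ℤ → ℝ → ℝ) (k i : ℤ) :
    backwardSol (fun j => T (j + k)) i = backwardSol T (i + k) := by
  have h := forwardSol_shift (fun j => T (-j - 1)) (-k) (-i)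
  have e1 : -i + -k = -(i + k) := by ring
  have e2 : ∀ j : ℤ, -(j + -k) - 1 = -j - 1 + k := fun j => by ring
  simp only [e1, e2] at h
  exact h

/-- Defining the solution as a limsup makes it measurable everywhere, including where the recursion
is never reset and the iterates need not settle. -/
theorem measurable_forwardSol {X : Type*} [MeasurableSpace X] {T : X → ℤ → ℝ → ℝ}
    (hT : ∀ i, Measurable fun p : X × ℝ => T p.1 i p.2) (i : ℤ) :
    Measurable fun x => forwardSol (T x) i := by
  refine Measurable.limsup fun m => ?_
  induction m generalizing i with
  | zero => exact measurable_const
  | succ m ih => exact (hT (i - 1)).comp (measurable_id.prodMk (ih (i - 1)))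

theorem measurable_backwardSol {X : Type*} [MeasurableSpace X] {T : X → ℤ → ℝ → ℝ}
    (hT : ∀ i, Measurable fun p : X × ℝ => T p.1 i p.2) (i : ℤ) :
    Measurable fun x => backwardSol (T x) i :=
  measurable_forwardSol (T := fun x j => T x (-j - 1)) (fun j => hT (-j - 1)) (-i)

/-! ### The canonical solution of the limit problem -/

noncomputable def limXL (x : ℤ → ℝ) : ℤ → ℝ :=
  forwardSol fun k u => max (1 - u) (1 - x k)

noncomputable def limXR (x : ℤ → ℝ) : ℤ → ℝ :=
  backwardSol fun k u => max (1 - u) (1 - x k)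

/-- Membership is coded by the reals `0` and `1`, so that the decisions form another resettable real
recursion. -/
noncomputable def limInclA (x : ℤ → ℝ) : ℤ → ℝ :=
  forwardSol fun k u => if (if 0 < u then x k else 0) < limXR x (k + 1) then 1 else 0

def limA (x : ℤ → ℝ) : Set ℤ := {i | 0 < limInclA x i}

noncomputable def limZL (θ : ℝ) (x : ℤ → ℝ) : ℤ → ℝ :=
  forwardSol fun k u => 1 - (if 0 < u then min u (x k) else 0) + θ * signJ (limA x) (k + 1)

noncomputable def limZR (θ : ℝ) (x : ℤ → ℝ) : ℤ → ℝ :=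
  backwardSol fun k u => 1 - (if 0 < u then min u (x k) else 0) + θ * signJ (limA x) k

/-- The weak inequality implements the tie rule in favour of inclusion. -/
noncomputable def limInclB (θ : ℝ) (x : ℤ → ℝ) : ℤ → ℝ :=
  forwardSol fun k u => if (if 0 < u then x k else 0) ≤ limZR θ x (k + 1) then 1 else 0

def limB (θ : ℝ) (x : ℤ → ℝ) : Set ℤ := {i | 0 < limInclB θ x i}

/-! ### Shift equivariance of the canonical solution -/

section Shift

variable (x : ℤ → ℝ) (k i : ℤ)

theorem limXL_shift : limXL (fun j => x (j + k)) i = limXL x (i + k) :=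
  forwardSol_shift (fun j u => max (1 - u) (1 - x j)) k i

theorem limXR_shift : limXR (fun j => x (j + k)) i = limXR x (i + k) :=
  backwardSol_shift (fun j u => max (1 - u) (1 - x j)) k i

theorem limInclA_shift : limInclA (fun j => x (j + k)) i = limInclA x (i + k) := by
  rw [limInclA, limInclA, ← forwardSol_shift]
  simp only [limXR_shift, add_right_comm _ k 1]

theorem mem_limA_shift : i ∈ limA (fun j => x (j + k)) ↔ i + k ∈ limA x := by
  change 0 < limInclA _ _ ↔ 0 < limInclA _ _
  rw [limInclA_shift]

theorem signJ_limA_shift : signJ (limA fun j => x (j + k)) i = signJ (limA x) (i + k) := by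
  have h := mem_limA_shift x k i
  by_cases h1 : i + k ∈ limA x
  · simp [signJ, h1, h.2 h1]
  · simp [signJ, h1, mt h.1 h1]

theorem limZL_shift (θ : ℝ) : limZL θ (fun j => x (j + k)) i = limZL θ x (i + k) := by
  rw [limZL, limZL, ← forwardSol_shift]
  simp only [signJ_limA_shift, add_right_comm _ k 1]

theorem limZR_shift (θ : ℝ) : limZR θ (fun j => x (j + k)) i = limZR θ x (i + k) := by
  rw [limZR, limZR, ← backwardSol_shift]
  simp only [signJ_limA_shift]

end Shift

/-! ### Measurability of the canonical solution -/

section Measurability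

theorem measurable_one_sub_max (i : ℤ) :
    Measurable fun p : (ℤ → ℝ) × ℝ => max (1 - p.2) (1 - p.1 i) :=
  (measurable_const.sub measurable_snd).max
    (measurable_const.sub ((measurable_pi_apply i).comp measurable_fst))

theorem measurable_limXL (i : ℤ) : Measurable fun x => limXL x i :=
  measurable_forwardSol (T := fun (x : ℤ → ℝ) k u => max (1 - u) (1 - x k)) measurable_one_sub_max i

theorem measurable_limXR (i : ℤ) : Measurable fun x => limXR x i :=
  measurable_backwardSol (T := fun (x : ℤ → ℝ) k u => max (1 - u) (1 - x k)) measurable_one_sub_max i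

theorem measurable_limInclA (i : ℤ) : Measurable fun x => limInclA x i := by
  refine measurable_forwardSol (T := fun x k u =>
    if (if 0 < u then x k else 0) < limXR x (k + 1) then 1 else 0) (fun i => ?_) i
  have h1 : Measurable fun p : (ℤ → ℝ) × ℝ => if 0 < p.2 then p.1 i else 0 :=
    Measurable.ite (measurableSet_lt measurable_const measurable_snd) (by fun_prop) (by fun_prop)
  exact Measurable.ite (measurableSet_lt h1 ((measurable_limXR (i + 1)).comp measurable_fst))
    measurable_const measurable_const

theorem measurableSet_limA (i : ℤ) : MeasurableSet {x | i ∈ limA x} :=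
  measurableSet_lt measurable_const (measurable_limInclA i)

theorem measurable_signJ_limA (i : ℤ) : Measurable fun x => signJ (limA x) i := by
  classical
  unfold signJ
  convert Measurable.ite (measurableSet_limA i) (measurable_const (a := (-1 : ℝ)))
    (measurable_const (a := (1 : ℝ)))

theorem measurable_modified (i j : ℤ) (θ : ℝ) : Measurable fun p : (ℤ → ℝ) × ℝ =>
    1 - (if 0 < p.2 then min p.2 (p.1 i) else 0) + θ * signJ (limA p.1) j := by
  have h1 : Measurable fun p : (ℤ → ℝ) × ℝ => if 0 < p.2 then min p.2 (p.1 i) else 0 :=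
    Measurable.ite (measurableSet_lt measurable_const measurable_snd) (by fun_prop) (by fun_prop)
  have h2 : Measurable fun p : (ℤ → ℝ) × ℝ => signJ (limA p.1) j :=
    (measurable_signJ_limA j).comp measurable_fst
  fun_prop

theorem measurable_limZL (θ : ℝ) (i : ℤ) : Measurable fun x => limZL θ x i :=
  measurable_forwardSol (T := fun x k u => 1 - (if 0 < u then min u (x k) else 0) +
    θ * signJ (limA x) (k + 1)) (fun i => measurable_modified i (i + 1) θ) i

theorem measurable_limZR (θ : ℝ) (i : ℤ) : Measurable fun x => limZR θ x i :=
  measurable_backwardSol (T := fun x k u => 1 - (if 0 < u then min u (x k) else 0) +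
    θ * signJ (limA x) k) (fun i => measurable_modified i i θ) i

theorem measurable_limInclB (θ : ℝ) (i : ℤ) : Measurable fun x => limInclB θ x i := by
  refine measurable_forwardSol (T := fun x k u =>
    if (if 0 < u then x k else 0) ≤ limZR θ x (k + 1) then 1 else 0) (fun i => ?_) i
  have h1 : Measurable fun p : (ℤ → ℝ) × ℝ => if 0 < p.2 then p.1 i else 0 :=
    Measurable.ite (measurableSet_lt measurable_const measurable_snd) (by fun_prop) (by fun_prop)
  exact Measurable.ite (measurableSet_le h1 ((measurable_limZR θ (i + 1)).comp measurable_fst))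
    measurable_const measurable_const

theorem measurableSet_limB (θ : ℝ) (i : ℤ) : MeasurableSet {x | i ∈ limB θ x} :=
  measurableSet_lt measurable_const (measurable_limInclB θ i)

end Measurability

/-- There are runs arbitrarily far to the left and to the right. -/
structure HasRuns (c : ℝ) (x : ℤ → ℝ) : Prop where
  left : ∀ i, ∃ s ≤ i, IsRun c x s
  right : ∀ i, ∃ s, i ≤ s ∧ IsRun c x s

/-! ### The recursions hold when there are runs on both sides -/

section Recursions

variable {c θ : ℝ} {x : ℤ → ℝ}

theorem limXL_succ (hc : c < 1 / 2) (hr : HasRuns c x) (i : ℤ) :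
    limXL x (i + 1) = max (1 - limXL x i) (1 - x i) := by
  refine forwardSol_succ (fun i => ?_) i
  obtain ⟨s, hs, h0, h1⟩ := hr.left i
  refine ⟨s, hs, 1 - x (s + 1), fun u => max_eq_right ?_⟩
  have := le_max_right (1 - u) (1 - x s)
  linarith

theorem limXR_eq (hc : c < 1 / 2) (hr : HasRuns c x) (i : ℤ) :
    limXR x i = max (1 - limXR x (i + 1)) (1 - x i) := by
  refine backwardSol_eq (T := fun k u => max (1 - u) (1 - x k)) (fun i => ?_) i
  obtain ⟨s, hs, h0, h1⟩ := hr.right i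
  refine ⟨s, hs, 1 - x s, fun u => max_eq_right ?_⟩
  have := le_max_right (1 - u) (1 - x (s + 1))
  linarith

/-- A run at `s` puts `s + 1` into the set whatever the state at `s`, so already the first of the
two steps resets the recursion. -/
theorem mem_limA_succ (hc : c < 1 / 2) (hc0 : 0 ≤ c) (hr : HasRuns c x) (i : ℤ) :
    i + 1 ∈ limA x ↔ stepCost x (limA x) i < limXR x (i + 1) := by
  have h : limInclA x (i + 1) =
      if (if 0 < limInclA x i then x i else 0) < limXR x (i + 1) then 1 else 0 := by
    refine forwardSol_succ (T := fun k u =>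
      if (if 0 < u then x k else 0) < limXR x (k + 1) then 1 else 0) (fun i => ?_) i
    obtain ⟨s, hs, h0, h1⟩ := hr.left i
    have hX : c < limXR x (s + 1) := by
      rw [limXR_eq hc hr]
      exact lt_max_of_lt_right (by linarith)
    have : ∀ u : ℝ, (if (if 0 < u then x s else 0) < limXR x (s + 1) then (1 : ℝ) else 0) = 1 := by
      intro u
      rw [if_pos]
      split_ifs <;> linarith
    refine ⟨s, hs, if (if 0 < (1 : ℝ) then x (s + 1) else 0) < limXR x (s + 1 + 1) then 1 else 0,
      fun u => ?_⟩
    rw [this]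
  change 0 < limInclA x (i + 1) ↔ _
  rw [h]
  unfold stepCost limA
  simp only [Set.mem_ofPred_eq]
  by_cases h1 : 0 < limInclA x i <;> simp only [h1, if_true, if_false] <;> split_ifs <;> simp_all

theorem modified_const (hθ : 0 < θ) (hc : c + θ < 1 / 2) (hc0 : 0 ≤ c) {y y' J J' : ℝ}
    (h1 : y ≤ c) (h2 : y' ≤ c) (hJ : -θ ≤ θ * J) (u : ℝ) :
    1 - (if 0 < 1 - (if 0 < u then min u y else 0) + θ * J then
      min (1 - (if 0 < u then min u y else 0) + θ * J) y' else 0) + θ * J' = 1 - y' + θ * J' := by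
  have h := modified_gt hθ hc (z := u) h1 hJ rfl hc0
  rw [if_pos (by linarith), min_eq_right (by linarith)]

theorem limZL_succ (hθ : 0 < θ) (hc : c + θ < 1 / 2) (hc0 : 0 ≤ c) (hr : HasRuns c x) (i : ℤ) :
    limZL θ x (i + 1) = 1 - (if 0 < limZL θ x i then min (limZL θ x i) (x i) else 0) +
      θ * signJ (limA x) (i + 1) := by
  refine forwardSol_succ (fun i => ?_) i
  obtain ⟨s, hs, h0, h1⟩ := hr.left i
  exact ⟨s, hs, _, fun u => modified_const hθ hc hc0 h0 h1 (neg_mul_signJ_le hθ _ _) u⟩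

theorem limZR_eq (hθ : 0 < θ) (hc : c + θ < 1 / 2) (hc0 : 0 ≤ c) (hr : HasRuns c x) (i : ℤ) :
    limZR θ x i = 1 - (if 0 < limZR θ x (i + 1) then min (limZR θ x (i + 1)) (x i) else 0) +
      θ * signJ (limA x) i := by
  refine backwardSol_eq (T := fun k u => 1 - (if 0 < u then min u (x k) else 0) +
    θ * signJ (limA x) k) (fun i => ?_) i
  obtain ⟨s, hs, h0, h1⟩ := hr.right i
  exact ⟨s, hs, _, fun u => modified_const hθ hc hc0 h1 h0 (neg_mul_signJ_le hθ _ _) u⟩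

theorem mem_limB_succ (hθ : 0 < θ) (hc : c + θ < 1 / 2) (hc0 : 0 ≤ c) (hr : HasRuns c x) (i : ℤ) :
    i + 1 ∈ limB θ x ↔ stepCost x (limB θ x) i ≤ limZR θ x (i + 1) := by
  have h : limInclB θ x (i + 1) =
      if (if 0 < limInclB θ x i then x i else 0) ≤ limZR θ x (i + 1) then 1 else 0 := by
    refine forwardSol_succ (T := fun k u =>
      if (if 0 < u then x k else 0) ≤ limZR θ x (k + 1) then 1 else 0) (fun i => ?_) i
    obtain ⟨s, hs, h0, h1⟩ := hr.left i
    have hX : c < limZR θ x (s + 1) :=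
      modified_gt hθ hc h1 (neg_mul_signJ_le hθ _ _) (limZR_eq hθ hc hc0 hr (s + 1)) hc0
    have : ∀ u : ℝ, (if (if 0 < u then x s else 0) ≤ limZR θ x (s + 1) then (1 : ℝ) else 0) = 1 := by
      intro u
      rw [if_pos]
      split_ifs <;> linarith
    refine ⟨s, hs,
      if (if 0 < (1 : ℝ) then x (s + 1) else 0) ≤ limZR θ x (s + 1 + 1) then 1 else 0,
      fun u => ?_⟩
    rw [this]
  change 0 < limInclB θ x (i + 1) ↔ _
  rw [h]
  unfold stepCost limB
  simp only [Set.mem_ofPred_eq]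
  by_cases h1 : 0 < limInclB θ x i <;> simp only [h1, if_true, if_false] <;> split_ifs <;> simp_all

theorem limIsLocalSystem (hθ : 0 < θ) (hc : c + θ < 1 / 2) (hc0 : 0 ≤ c) (hr : HasRuns c x)
    (a b : ℤ) : IsLocalSystem θ x (limXR x) (limZR θ x) (limA x) (limB θ x) a b where
  XR_rec i _ _ := limXR_eq (by linarith) hr i
  A_mem i _ _ := (mem_limA_succ (by linarith) hc0 hr i).2
  A_notMem i _ _ h h1 := by linarith [(mem_limA_succ (by linarith) hc0 hr i).1 h1]
  ZR_rec i _ _ := limZR_eq hθ hc hc0 hr i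
  B_iff i _ _ := mem_limB_succ hθ hc hc0 hr i

end Recursions

/-! ### I.i.d. families -/

/-- `X` is an i.i.d. family with law `ν`. -/
structure IsIID {ι Ω : Type*} [MeasurableSpace Ω] (P : Measure Ω) (ν : Measure ℝ)
    (X : ι → Ω → ℝ) : Prop where
  meas : ∀ i, Measurable (X i)
  law : ∀ i, P.map (X i) = ν
  indep : iIndepFun X P

section IID

variable {ι κ Ω : Type*} [MeasurableSpace Ω] {P : Measure Ω} {ν : Measure ℝ} {X : ι → Ω → ℝ}

theorem IsIID.precomp (h : IsIID P ν X) {f : κ → ι} (hf : Function.Injective f) :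
    IsIID P ν (fun k => X (f k)) :=
  ⟨fun k => h.meas (f k), fun k => h.law (f k), h.indep.precomp hf⟩

theorem IsIID.map_eq_pi [IsProbabilityMeasure P] [Fintype ι] (h : IsIID P ν X) :
    P.map (fun ω i => X i ω) = Measure.pi fun _ => ν := by
  rw [(iIndepFun_iff_map_fun_eq_pi_map fun i => (h.meas i).aemeasurable).1 h.indep]
  simp only [h.law]

theorem IsIID.map_eq_infinitePi [IsProbabilityMeasure P] (h : IsIID P ν X) :
    P.map (fun ω i => X i ω) = Measure.infinitePi fun _ => ν := by
  rw [(iIndepFun_iff_map_fun_eq_infinitePi_map h.meas).1 h.indep]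
  simp only [h.law]

theorem isIID_infinitePi (ι : Type*) (ν : Measure ℝ) [IsProbabilityMeasure ν] :
    IsIID (Measure.infinitePi fun _ : ι => ν) ν (fun i x => x i) :=
  ⟨fun i => measurable_pi_apply i, fun i => Measure.infinitePi_map_eval (fun _ => ν) i,
    iIndepFun_infinitePi (X := fun _ u => u) fun _ => measurable_id⟩

/-- A law on `(0, ∞)` without atoms. -/
structure IsPosDiffuse (ν : Measure ℝ) : Prop where
  prob : IsProbabilityMeasure ν
  diffuse : NullSingletonClass ν
  pos : ∀ᵐ t ∂ν, 0 < t

theorem IsCostLaw.isPosDiffuse {ν : Measure ℝ} (h : IsCostLaw ν) : IsPosDiffuse ν := by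
  obtain ⟨h1, g, -, -, -, -, hg⟩ := h
  have hac : ν ≪ volume.restrict (Set.Ioi (0 : ℝ)) := by
    rw [hg]; exact withDensity_absolutelyContinuous _ _
  refine ⟨h1, ⟨fun t => hac ?_⟩, hac.ae_le (ae_restrict_mem measurableSet_Ioi)⟩
  exact measure_singleton t

/-- The pair has law `ν × ν`, and every section of a line `u = r + σ t` at fixed `t` is a single
point, which `ν` does not charge. -/
theorem IsIID.ae_ne_affine [IsProbabilityMeasure P] (hν : IsPosDiffuse ν) (h : IsIID P ν X)
    {i j : ι} (hij : i ≠ j) (r σ : ℝ) : ∀ᵐ ω ∂P, X i ω ≠ r + σ * X j ω := by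
  have := hν.prob
  have := hν.diffuse
  have hlaw := (indepFun_iff_map_prod_eq_prod_map_map (h.meas j).aemeasurable
    (h.meas i).aemeasurable).1 (h.indep.indepFun hij.symm)
  rw [h.law, h.law] at hlaw
  have hms : MeasurableSet {p : ℝ × ℝ | p.2 = r + σ * p.1} :=
    measurableSet_eq_fun (by fun_prop) (by fun_prop)
  have h0 : (ν.prod ν) {p : ℝ × ℝ | p.2 = r + σ * p.1} = 0 := by
    rw [Measure.measure_prod_null hms]
    refine Eventually.of_forall fun t => ?_
    have : Prod.mk t ⁻¹' {p : ℝ × ℝ | p.2 = r + σ * p.1} = {r + σ * t} := by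
      ext u; simp
    change ν (Prod.mk t ⁻¹' {p : ℝ × ℝ | p.2 = r + σ * p.1}) = 0
    rw [this]
    exact measure_singleton _
  rw [← hlaw, Measure.map_apply ((h.meas j).prodMk (h.meas i)) hms] at h0
  rw [ae_iff]
  simpa using h0

theorem IsIID.ae_isGenericOn [Countable ι] [IsProbabilityMeasure P] (hν : IsPosDiffuse ν)
    (h : IsIID P ν X) (θ : ℝ) : ∀ᵐ ω ∂P, IsGenericOn θ (fun i => X i ω) Set.univ := by
  have := hν.diffuse
  have h1 : ∀ᵐ ω ∂P, ∀ i, 0 < X i ω := ae_all_iff.2 fun i =>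
    ae_of_ae_map (h.meas i).aemeasurable (by rw [h.law]; exact hν.pos)
  have h2 : ∀ᵐ ω ∂P, ∀ i, ∀ p q : ℤ, X i ω ≠ p + q * θ := by
    simp only [ae_all_iff]
    intro i p q
    refine ae_of_ae_map (p := fun t => t ≠ p + q * θ) (h.meas i).aemeasurable ?_
    rw [h.law, ae_iff]
    simp
  have h3 : ∀ᵐ ω ∂P, ∀ i j, i ≠ j → ∀ p q : ℤ, X i ω ≠ (p + q * θ) + 1 * X j ω := by
    simp only [ae_all_iff]
    exact fun i j hij p q => h.ae_ne_affine hν hij _ _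
  have h4 : ∀ᵐ ω ∂P, ∀ i j, i ≠ j → ∀ p q : ℤ, X i ω ≠ (p + q * θ) + (-1) * X j ω := by
    simp only [ae_all_iff]
    exact fun i j hij p q => h.ae_ne_affine hν hij _ _
  filter_upwards [h1, h2, h3, h4] with ω h1 h2 h3 h4
  refine ⟨fun i _ => h1 i, fun i _ => h2 i, fun i _ j _ hij p q => ?_, fun i _ j _ hij p q => ?_⟩
  · simpa using h3 i j hij p q
  · simpa [sub_eq_add_neg] using h4 i j hij p q

end IID

/-! ### The law of large numbers for functions of a moving window -/

/-- If the averages along each residue class converge to `E`, so do the full averages. -/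
theorem tendsto_average_of_residues {L : ℕ} (hL : 0 < L) {f : ℕ → ℝ} {C E : ℝ}
    (hC : ∀ i, |f i| ≤ C)
    (h : ∀ r < L, Tendsto (fun q : ℕ => (∑ j ∈ Finset.range q, f (j * L + r)) / q) atTop (𝓝 E)) :
    Tendsto (fun n : ℕ => (∑ i ∈ Finset.range n, f i) / n) atTop (𝓝 E) := by
  have hLR : (0 : ℝ) < L := by exact_mod_cast hL
  have hC0 : 0 ≤ C := (abs_nonneg _).trans (hC 0)
  have hblock : ∀ q : ℕ, ∑ i ∈ Finset.range (q * L), f i =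
      ∑ r ∈ Finset.range L, ∑ j ∈ Finset.range q, f (j * L + r) := by
    intro q
    rw [Finset.sum_comm]
    induction q with
    | zero => simp
    | succ q ih => rw [Nat.succ_mul, Finset.sum_range_add, ih, Finset.sum_range_succ]
  have h1 : Tendsto (fun q : ℕ => (∑ i ∈ Finset.range (q * L), f i) / q) atTop (𝓝 (L * E)) := by
    have := tendsto_finsetSum (Finset.range L) fun r hr => h r (Finset.mem_range.1 hr)
    simp only [Finset.sum_const, Finset.card_range, nsmul_eq_mul] at this
    refine this.congr fun q => ?_
    rw [hblock, Finset.sum_div]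
  have h2 := h1.comp (Nat.tendsto_div_const_atTop hL.ne')
  have h3 : Tendsto (fun n : ℕ => ((n / L : ℕ) : ℝ) / n) atTop (𝓝 ((L : ℝ)⁻¹)) := by
    have := (tendsto_nat_floor_mul_div_atTop (R := ℝ) (a := (L : ℝ)⁻¹) (by positivity)).comp
      tendsto_natCast_atTop_atTop
    refine this.congr fun n => ?_
    simp only [Function.comp_apply]
    rw [inv_mul_eq_div, Nat.floor_div_eq_div]
  have h4 : Tendsto (fun n : ℕ => L * C / (n : ℝ)) atTop (𝓝 0) :=
    tendsto_const_nhds.div_atTop tendsto_natCast_atTop_atTop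
  have h5 := h2.mul h3
  have e : L * E * (L : ℝ)⁻¹ = E := by field_simp
  rw [e] at h5
  have h6 : Tendsto (fun n : ℕ => (∑ i ∈ Finset.range n, f i) / n -
      (∑ i ∈ Finset.range (n / L * L), f i) / ((n / L : ℕ) : ℝ) * (((n / L : ℕ) : ℝ) / n))
      atTop (𝓝 0) := by
    refine squeeze_zero_norm' ?_ h4
    filter_upwards [eventually_ge_atTop L] with n hn
    have hq : (0 : ℝ) < ((n / L : ℕ) : ℝ) := by exact_mod_cast Nat.div_pos hn hL
    have hn0 : (0 : ℝ) < n := by exact_mod_cast hL.trans_le hn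
    rw [div_mul_div_cancel₀ hq.ne', ← sub_div, Real.norm_eq_abs, abs_div, abs_of_pos hn0]
    have hsplit : ∑ i ∈ Finset.range n, f i = ∑ i ∈ Finset.range (n / L * L), f i +
        ∑ i ∈ Finset.range (n % L), f (n / L * L + i) := by
      rw [← Finset.sum_range_add, Nat.div_add_mod' n L]
    rw [hsplit, add_sub_cancel_left]
    refine div_le_div_of_nonneg_right ?_ hn0.le
    refine (Finset.abs_sum_le_sum_abs _ _).trans ((Finset.sum_le_card_nsmul _ _ C
      fun i _ => hC _).trans ?_)
    rw [Finset.card_range, nsmul_eq_mul]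
    have : ((n % L : ℕ) : ℝ) ≤ L := by exact_mod_cast (Nat.mod_lt n hL).le
    exact mul_le_mul_of_nonneg_right this hC0
  have := h6.add h5
  simp only [zero_add] at this
  refine this.congr fun n => ?_
  simp [Function.comp_apply]

/-- Windows of length `L` whose starting points are congruent modulo `L` are disjoint, hence
independent. The strong law applies along each residue class, and the classes are then averaged. -/
theorem IsIID.window_lln {Ω : Type*} [MeasurableSpace Ω] {P : Measure Ω} [IsProbabilityMeasure P]
    {ν : Measure ℝ} {X : ℕ → Ω → ℝ} (hX : IsIID P ν X) {L : ℕ} (hL : 0 < L)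
    {h : (Fin L → ℝ) → ℝ} (hm : Measurable h) {C : ℝ} (hC : ∀ v, |h v| ≤ C) :
    ∀ᵐ ω ∂P, Tendsto (fun n : ℕ => (∑ i ∈ Finset.range n, h fun a => X (i + a) ω) / n) atTop
      (𝓝 (∫ v, h v ∂Measure.pi fun _ => ν)) := by
  have hlaw : ∀ i : ℕ, P.map (fun ω (a : Fin L) => X (i + a) ω) = Measure.pi fun _ => ν :=
    fun i => (hX.precomp (f := fun a : Fin L => i + (a : ℕ))
      fun a b hab => Fin.ext (by simpa using hab)).map_eq_pi
  have hmeas : ∀ i : ℕ, Measurable fun ω (a : Fin L) => X (i + a) ω := fun i =>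
    measurable_pi_lambda _ fun a => hX.meas _
  have key : ∀ r < L, ∀ᵐ ω ∂P, Tendsto (fun q : ℕ => (∑ j ∈ Finset.range q,
      h fun a => X (j * L + r + a) ω) / q) atTop (𝓝 (∫ v, h v ∂Measure.pi fun _ => ν)) := by
    intro r _
    have := strong_law_ae_real (μ := P) (fun j ω => h fun a => X (j * L + r + a) ω) ?_ ?_ ?_
    · refine this.mono fun ω hω => ?_
      have e : ∫ ω, h (fun a : Fin L => X (0 * L + r + a) ω) ∂P =
          ∫ v, h v ∂Measure.pi fun _ => ν := by
        rw [← hlaw (0 * L + r),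
          integral_map (hmeas _).aemeasurable hm.aestronglyMeasurable]
      rwa [e] at hω
    · exact Integrable.of_bound (hm.comp (hmeas _)).aestronglyMeasurable C
        (Eventually.of_forall fun ω => hC _)
    · intro j k hjk
      have hdisj : Disjoint (Finset.Ico (j * L + r) (j * L + r + L))
          (Finset.Ico (k * L + r) (k * L + r + L)) := by
        rw [Finset.disjoint_left]
        intro i h1 h2
        rw [Finset.mem_Ico] at h1 h2
        rcases lt_or_gt_of_ne hjk with hlt | hlt
        · have : (j + 1) * L ≤ k * L := Nat.mul_le_mul_right L hlt
          rw [Nat.succ_mul] at this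
          lia
        · have : (k + 1) * L ≤ j * L := Nat.mul_le_mul_right L hlt
          rw [Nat.succ_mul] at this
          lia
      have hind := hX.indep.indepFun_finset _ _ hdisj hX.meas
      have hsel : ∀ j : ℕ, Measurable fun (v : Finset.Ico (j * L + r) (j * L + r + L) → ℝ) =>
          h fun a : Fin L => v ⟨j * L + r + a, Finset.mem_Ico.2 ⟨by lia, by lia⟩⟩ := fun j =>
        hm.comp (measurable_pi_lambda _ fun a => measurable_pi_apply _)
      exact hind.comp (hsel j) (hsel k)
    · intro j
      refine ⟨(hm.comp (hmeas _)).aemeasurable, (hm.comp (hmeas _)).aemeasurable, ?_⟩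
      have : ∀ i : ℕ, P.map (fun ω => h fun a : Fin L => X (i + a) ω) =
          (Measure.pi fun _ => ν).map h := fun i => by
        rw [← hlaw i, Measure.map_map hm (hmeas i)]; rfl
      rw [this, this]
  have key' : ∀ᵐ ω ∂P, ∀ r < L, Tendsto (fun q : ℕ => (∑ j ∈ Finset.range q,
      h fun a => X (j * L + r + a) ω) / q) atTop (𝓝 (∫ v, h v ∂Measure.pi fun _ => ν)) := by
    rw [ae_all_iff]
    intro r
    by_cases hr : r < L
    · exact (key r hr).mono fun ω h _ => h
    · exact Eventually.of_forall fun ω h => absurd h hr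
  exact key'.mono fun ω hω => tendsto_average_of_residues hL (fun i => hC _) hω

/-! ### Existence of runs -/

/-- By the window law with `L = 2`, the frequency of runs tends to a positive number; if no run
occurred from `n` on, it would tend to zero. -/
theorem IsIID.ae_frequently_run {Ω : Type*} [MeasurableSpace Ω] {P : Measure Ω}
    [IsProbabilityMeasure P] {ν : Measure ℝ} [IsProbabilityMeasure ν] {X : ℕ → Ω → ℝ}
    (hX : IsIID P ν X) {c : ℝ} (hc : 0 < ν (Set.Iic c)) :
    ∀ᵐ ω ∂P, ∀ n, ∃ i, n ≤ i ∧ X i ω ≤ c ∧ X (i + 1) ω ≤ c := by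
  classical
  set s : Set (Fin 2 → ℝ) := Set.univ.pi fun _ => Set.Iic c with hs
  have hsm : MeasurableSet s := MeasurableSet.univ_pi fun _ => measurableSet_Iic
  have hE : 0 < ∫ v, s.indicator (1 : (Fin 2 → ℝ) → ℝ) v ∂Measure.pi fun _ => ν := by
    rw [integral_indicator_one hsm, measureReal_def, Measure.pi_pi, ENNReal.toReal_pos_iff]
    refine ⟨?_, ?_⟩
    · simp only [Fin.prod_univ_two]
      exact ENNReal.mul_pos hc.ne' hc.ne'
    · simp only [Fin.prod_univ_two]
      exact ENNReal.mul_lt_top (measure_lt_top _ _) (measure_lt_top _ _)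
  have h := hX.window_lln two_pos (h := s.indicator (1 : (Fin 2 → ℝ) → ℝ)) (measurable_one.indicator hsm) (C := 1)
    fun v => by by_cases hv : v ∈ s <;> simp [hv]
  filter_upwards [h] with ω hω n
  by_contra! hcon
  have hz : ∀ i, n ≤ i → s.indicator (1 : (Fin 2 → ℝ) → ℝ) (fun a => X (i + a) ω) = 0 := by
    intro i hi
    refine Set.indicator_of_notMem (fun hmem => ?_) _
    have h0 := hmem 0 trivial
    have h1 := hmem 1 trivial
    simp only [Set.mem_Iic, Fin.val_zero, Fin.val_one, add_zero] at h0 h1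
    exact (hcon i hi h0).not_ge h1
  have hsum : ∀ m, n ≤ m → ∑ i ∈ Finset.range m,
      s.indicator (1 : (Fin 2 → ℝ) → ℝ) (fun a => X (i + a) ω) = ∑ i ∈ Finset.range n,
      s.indicator (1 : (Fin 2 → ℝ) → ℝ) (fun a => X (i + a) ω) := by
    intro m hm
    refine (Finset.sum_subset (Finset.range_subset_range.2 hm) fun i _ hi => ?_).symm
    exact hz i (by simpa using hi)
  have h0 : Tendsto (fun m : ℕ => (∑ i ∈ Finset.range n,
      s.indicator (1 : (Fin 2 → ℝ) → ℝ) (fun a => X (i + a) ω)) / (m : ℝ)) atTop (𝓝 0) :=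
    tendsto_const_nhds.div_atTop tendsto_natCast_atTop_atTop
  refine hE.ne' (tendsto_nhds_unique (hω.congr' ?_) h0)
  filter_upwards [eventually_ge_atTop n] with m hm
  rw [hsum m hm]

theorem IsIID.ae_hasRuns {Ω : Type*} [MeasurableSpace Ω] {P : Measure Ω}
    [IsProbabilityMeasure P] {ν : Measure ℝ} [IsProbabilityMeasure ν] {X : ℤ → Ω → ℝ}
    (hX : IsIID P ν X) {c : ℝ} (hc : 0 < ν (Set.Iic c)) :
    ∀ᵐ ω ∂P, HasRuns c fun i => X i ω := by
  have h1 := (hX.precomp (f := fun i : ℕ => (i : ℤ)) Nat.cast_injective).ae_frequently_run hc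
  have h2 := (hX.precomp (f := fun i : ℕ => -(i : ℤ))
    (neg_injective.comp Nat.cast_injective)).ae_frequently_run hc
  filter_upwards [h1, h2] with ω h1 h2
  refine ⟨fun i => ?_, fun i => ?_⟩
  · obtain ⟨j, hj, ha, hb⟩ := h2 (-i).toNat
    -- Reflection exchanges the two costs of the run, so it now starts at `-(j + 1)`.
    refine ⟨-(j + 1 : ℕ), by lia, hb, ?_⟩
    have e : -((j + 1 : ℕ) : ℤ) + 1 = -(j : ℤ) := by push_cast; ring
    rw [e]
    exact ha
  · obtain ⟨j, hj, ha, hb⟩ := h1 i.toNat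
    exact ⟨j, by lia, ha, by simpa using hb⟩

attribute [instance] StationaryQuintuple.mΩ StationaryQuintuple.isProb

/-! ### Relative benefits of pairs -/

theorem relBenefit_true_sub_false (zL x zR : ℝ) (p : Prop) [Decidable p] :
    relBenefit zL x zR p True - relBenefit zL x zR p False = zR - if p then x else 0 := by
  by_cases h : p <;> simp [relBenefit, h]
  ring

/-- If including the left item is always better and the right decision is optimal given the left
one, then the pair of decisions is optimal. -/
theorem relBenefit_le_of_left {zL x zR : ℝ} (hx : 0 ≤ x) (hz : x ≤ zL) {q : Prop}
    (h1 : q → x ≤ zR) (h2 : ¬ q → zR ≤ x) (p' q' : Prop) :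
    relBenefit zL x zR p' q' ≤ relBenefit zL x zR True q := by
  by_cases hp : p' <;> by_cases hq' : q' <;> by_cases hq : q <;>
    simp only [hq, not_true, not_false_iff, forall_true_left] at h1 h2 <;>
    simp [relBenefit, hp, hq', hq] <;> linarith

theorem max_form_eq {z y : ℝ} (hy : 0 ≤ y) :
    (if 0 < z then min z y else 0) = max 0 z - max 0 (z - y) := by
  split_ifs with h
  · rw [max_eq_right h.le]
    rcases le_total z y with h' | h'
    · rw [min_eq_left h', max_eq_left (by linarith)]; ring
    · rw [min_eq_right h', max_eq_right (by linarith)]; ring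
  · rw [max_eq_left (not_lt.1 h), max_eq_left (by linarith)]; ring

/-- Optimality of the pairs propagates to the right, if decisions are optimal given the previous
one. -/
theorem relBenefit_le_succ {w zL x zR y zR' zL' : ℝ} (hx : 0 ≤ x) (hy : 0 ≤ y)
    (hR : zR = w - if 0 < zR' then min zR' y else 0)
    (hL : zL' = w - if 0 < zL then min zL x else 0) {p q r : Prop}
    (hmax : ∀ p' q' : Prop, relBenefit zL x zR p' q' ≤ relBenefit zL x zR p q)
    (h1 : r → (q → y ≤ zR') ∧ (¬ q → 0 ≤ zR')) (h2 : ¬ r → (q → zR' ≤ y) ∧ (¬ q → zR' ≤ 0))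
    (q' r' : Prop) : relBenefit zL' y zR' q' r' ≤ relBenefit zL' y zR' q r := by
  rw [max_form_eq hy] at hR
  rw [max_form_eq hx] at hL
  have l1 := le_max_left 0 zR'
  have l2 := le_max_right 0 zR'
  have l3 := le_max_left 0 (zR' - y)
  have l4 := le_max_right 0 (zR' - y)
  have l5 := le_max_left 0 zL
  have l6 := le_max_right 0 zL
  have l7 := le_max_left 0 (zL - x)
  have l8 := le_max_right 0 (zL - x)
  by_cases hq : q
  -- The left side is the best relative benefit of the old pair without the middle item, the right
  -- side the best one with it. The recursions for `zR` and `zL'` carry this comparison over to the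
  -- new pair.
  · have key : max 0 zL ≤ zR + max 0 (zL - x) := by
      have a1 := hmax True False
      have a2 := hmax False False
      by_cases hp : p <;> simp [relBenefit, hp, hq] at a1 a2 <;> exact max_le (by linarith) (by linarith)
    have val : relBenefit zL' y zR' q r = zL' + max 0 (zR' - y) := by
      by_cases hr : r
      · rw [max_eq_right (by linarith [(h1 hr).1 hq])]
        simp [relBenefit, hq, hr]; ring
      · rw [max_eq_left (by linarith [(h2 hr).1 hq])]
        simp [relBenefit, hq, hr]
    rw [val]
    by_cases hq' : q' <;> by_cases hr' : r' <;> simp [relBenefit, hq', hr'] <;> linarith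
  · have key : zR + max 0 (zL - x) ≤ max 0 zL := by
      have a1 := hmax True True
      have a2 := hmax False True
      rcases max_cases 0 (zL - x) with ⟨m, -⟩ | ⟨m, -⟩ <;> rw [m] <;>
        by_cases hp : p <;> simp [relBenefit, hp, hq] at a1 a2 <;> linarith
    have val : relBenefit zL' y zR' q r = max 0 zR' := by
      by_cases hr : r
      · rw [max_eq_right ((h1 hr).2 hq)]
        simp [relBenefit, hq, hr]
      · rw [max_eq_left ((h2 hr).2 hq)]
        simp [relBenefit, hq, hr]
    rw [val]
    by_cases hq' : q' <;> by_cases hr' : r' <;> simp [relBenefit, hq', hr', -le_sup_iff] <;> linarith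

/-- Decisions which are optimal given the previous one are optimal for each pair. -/
theorem relBenefit_le_of_step {c : ℝ} {x zL zR w : ℤ → ℝ} {S : Set ℤ} (hx : ∀ i, 0 ≤ x i)
    (hruns : HasRuns c x)
    (hL : ∀ i, zL (i + 1) = w (i + 1) - if 0 < zL i then min (zL i) (x i) else 0)
    (hR : ∀ i, zR i = w i - if 0 < zR (i + 1) then min (zR (i + 1)) (x i) else 0)
    (hbig : ∀ i, x i ≤ c → c < zL (i + 1) ∧ c < zR i)
    (hmem : ∀ i, i + 1 ∈ S → stepCost x S i ≤ zR (i + 1))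
    (hnot : ∀ i, i + 1 ∉ S → zR (i + 1) ≤ stepCost x S i) (i : ℤ) (p q : Prop) :
    relBenefit (zL i) (x i) (zR (i + 1)) p q ≤
      relBenefit (zL i) (x i) (zR (i + 1)) (i ∈ S) (i + 1 ∈ S) := by
  -- Pairwise optimality is verified directly just after a run, where item `s + 1` is certainly
  -- included, and then propagated rightwards to `i`.
  obtain ⟨s, hs, h0, h1⟩ := hruns.left (i - 1)
  have hs' : s + 1 ≤ i := by lia
  have hsc : ∀ i, (i ∈ S → stepCost x S i = x i) ∧ (i ∉ S → stepCost x S i = 0) :=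
    fun i => ⟨fun h => by simp [stepCost, h], fun h => by simp [stepCost, h]⟩
  clear hs
  induction i, hs' using Int.leInduction generalizing p q with
  | base =>
    have hin : s + 1 ∈ S := by
      by_contra hn
      have hc0 := (hx s).trans h0
      linarith [hnot s hn, (hbig (s + 1) h1).2, stepCost_le (S := S) hc0 h0]
    have := relBenefit_le_of_left (hx (s + 1)) (zL := zL (s + 1)) (zR := zR (s + 1 + 1))
      (by linarith [(hbig s h0).1]) (q := s + 1 + 1 ∈ S)
      (fun h => by rw [← (hsc _).1 hin]; exact hmem _ h)
      (fun h => by rw [← (hsc _).1 hin]; exact hnot _ h) p q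
    simpa only [eq_true hin] using this
  | succ k hk ih =>
    refine relBenefit_le_succ (hx k) (hx (k + 1)) (hR (k + 1)) (hL k) ih
      (fun h => ⟨fun hq => ?_, fun hq => ?_⟩) (fun h => ⟨fun hq => ?_, fun hq => ?_⟩) p q
    · rw [← (hsc _).1 hq]; exact hmem _ h
    · rw [← (hsc _).2 hq]; exact hmem _ h
    · rw [← (hsc _).1 hq]; exact hnot _ h
    · rw [← (hsc _).2 hq]; exact hnot _ h

/-! ### Ties in the limit problem -/

theorem forward_form {θ c : ℝ} (hc : c < 1 / 2) {x XL : ℤ → ℝ}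
    (hrec : ∀ i, XL (i + 1) = max (1 - XL i) (1 - x i)) (hr : HasRuns c x)
    (hg : IsGenericOn θ x Set.univ) (i : ℤ) :
    (∃ j < i, XL i = x j ∨ XL i = 1 - x j) ∧ 0 ≤ XL i ∧ XL i ≤ 1 := by
  obtain ⟨s, hs, h0, h1⟩ := hr.left (i - 2)
  -- Reflection of the line: the cost `x k` joins `k` and `k + 1`, so it moves to `-k - 1`, and a
  -- run at `s` becomes a run at `-s - 2`.
  have h := backward_form hc (x := fun j => x (-j - 1)) (XR := fun j => XL (-j)) (a := -i)
    (t := -s - 2) (fun j _ _ => ?_) ⟨?_, ?_⟩ (fun j _ _ => hg.pos _ trivial) le_rfl (by lia)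
  · rw [neg_neg] at h
    obtain ⟨⟨j, hj1, -, hj⟩, h2⟩ := h
    exact ⟨⟨-j - 1, by lia, hj⟩, h2⟩
  · have := hrec (-j - 1)
    have e : -(j + 1) = -j - 1 := by ring
    rw [sub_add_cancel] at this
    rw [e]
    exact this
  · have e : -(-s - 2) - 1 = s + 1 := by ring
    simpa only [e] using h1
  · have e : -(-s - 2 + 1) - 1 = s := by ring
    simpa only [e] using h0

theorem backward_form' {θ c : ℝ} (hc : c < 1 / 2) {x XR : ℤ → ℝ}
    (hrec : ∀ i, XR i = max (1 - XR (i + 1)) (1 - x i)) (hr : HasRuns c x)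
    (hg : IsGenericOn θ x Set.univ) (i : ℤ) :
    (∃ j, i ≤ j ∧ (XR i = x j ∨ XR i = 1 - x j)) ∧ 0 ≤ XR i ∧ XR i ≤ 1 := by
  obtain ⟨s, hs, h⟩ := hr.right i
  obtain ⟨⟨j, h1, -, h2⟩, h3⟩ := backward_form hc (a := i) (fun j _ _ => hrec j) h
    (fun j _ _ => hg.pos _ trivial) le_rfl hs
  exact ⟨⟨j, h1, h2⟩, h3⟩

/-- The three quantities compared in the inclusion criteria for `A` are distinct. -/
theorem criteria_ne {θ c : ℝ} (hc : c < 1 / 2) {x XL XR : ℤ → ℝ}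
    (hL : ∀ i, XL (i + 1) = max (1 - XL i) (1 - x i))
    (hR : ∀ i, XR i = max (1 - XR (i + 1)) (1 - x i)) (hr : HasRuns c x)
    (hg : IsGenericOn θ x Set.univ) (i : ℤ) :
    XL i ≠ x i ∧ XR (i + 1) ≠ x i ∧ XL i ≠ XR (i + 1) := by
  obtain ⟨⟨j, hj, hjL⟩, -⟩ := forward_form hc hL hr hg i
  obtain ⟨⟨k, hk, hkR⟩, -⟩ := backward_form' hc hR hr hg (i + 1)
  refine ⟨ne_of_form hg trivial (j := j) trivial (by lia) hjL,
    ne_of_form hg trivial (j := k) trivial (by lia) hkR, ?_⟩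
  have hjk : k ≠ j := by lia
  rcases hkR with h | h
  · rw [h]; exact ne_of_form hg trivial (j := j) trivial hjk hjL
  · rw [h]
    intro h'
    refine ne_of_form hg (i := k) (j := j) trivial trivial hjk (r := 1 - XL i) ?_ (by linarith)
    rcases hjL with h2 | h2
    · right; rw [h2]
    · left; rw [h2]; ring

/-- The cost and the two values are distinct, so exactly one of them is the strict minimum and the
rule fixes both decisions. The left-to-right form follows by cases, using `XR ≥ 0` when `i` is
excluded. -/
theorem A_step_of_rule {θ c : ℝ} (hc : c < 1 / 2) {x XL XR : ℤ → ℝ} {A : Set ℤ}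
    (hL : ∀ i, XL (i + 1) = max (1 - XL i) (1 - x i))
    (hR : ∀ i, XR i = max (1 - XR (i + 1)) (1 - x i)) (hr : HasRuns c x)
    (hg : IsGenericOn θ x Set.univ)
    (hA : ∀ i, (x i < min (XL i) (XR (i + 1)) → i ∈ A ∧ i + 1 ∈ A) ∧
      (XR (i + 1) < min (XL i) (x i) → i ∈ A ∧ i + 1 ∉ A) ∧
      (XL i < min (XR (i + 1)) (x i) → i ∉ A ∧ i + 1 ∈ A)) (i : ℤ) :
    (stepCost x A i < XR (i + 1) → i + 1 ∈ A) ∧ (XR (i + 1) < stepCost x A i → i + 1 ∉ A) := by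
  obtain ⟨n1, n2, n3⟩ := criteria_ne hc hL hR hr hg i
  have hpos := (backward_form' hc hR hr hg (i + 1)).2.1
  obtain ⟨a1, a2, a3⟩ := hA i
  rcases lt_or_gt_of_ne n1 with h1 | h1 <;> rcases lt_or_gt_of_ne n2 with h2 | h2 <;>
    rcases lt_or_gt_of_ne n3 with h3 | h3
  · obtain ⟨b1, b2⟩ := a3 (lt_min h3 h1)
    simp only [stepCost, b1, b2, if_false]
    exact ⟨fun _ => trivial, fun h => by linarith⟩
  · obtain ⟨b1, b2⟩ := a2 (lt_min h3 h2)
    simp only [stepCost, b1, b2, if_true]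
    exact ⟨fun h => by linarith, fun _ => not_false⟩
  · obtain ⟨b1, b2⟩ := a3 (lt_min h3 h1)
    simp only [stepCost, b1, b2, if_false]
    exact ⟨fun _ => trivial, fun h => by linarith⟩
  · linarith
  · linarith
  · obtain ⟨b1, b2⟩ := a2 (lt_min h3 h2)
    simp only [stepCost, b1, b2, if_true]
    exact ⟨fun h => by linarith, fun _ => not_false⟩
  · obtain ⟨b1, b2⟩ := a1 (lt_min h1 h2)
    simp only [stepCost, b1, b2, if_true]
    exact ⟨fun _ => trivial, fun h => by linarith⟩
  · obtain ⟨b1, b2⟩ := a1 (lt_min h1 h2)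
    simp only [stepCost, b1, b2, if_true]
    exact ⟨fun _ => trivial, fun h => by linarith⟩

theorem relBenefit_lt_iff {zL zR : ℝ} {x : ℤ → ℝ} {S : Set ℤ} {i : ℤ} :
    relBenefit zL (x i) zR (i ∈ S) True < relBenefit zL (x i) zR (i ∈ S) False ↔
      zR < stepCost x S i := by
  classical
  have := relBenefit_true_sub_false zL (x i) zR (i ∈ S)
  have e : (if i ∈ S then x i else 0) = stepCost x S i := by
    unfold stepCost; congr
  rw [e] at this
  constructor <;> intro h <;> linarith

/-! ### The costs and decisions of a stationary quintuple -/

namespace StationaryQuintuple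

variable {ν : Measure ℝ} {θ : ℝ} (Q : StationaryQuintuple.{u} ν θ)

theorem isIID : IsIID Q.P ν Q.ξ := ⟨Q.measurable_ξ, Q.law_ξ, Q.indep_ξ⟩

/-- For fixed decision at `i`, the choice at `i + 1` does not depend on `ZL`. Maximality of the pair
gives one direction of the threshold rule for `B`, the tie rule the other. -/
theorem ae_isLocalSystem (hν : IsPosDiffuse ν) {c : ℝ} (hc : c < 1 / 2)
    (hνc : 0 < ν (Set.Iic c)) :
    ∀ᵐ ω ∂Q.P, HasRuns c (fun i => Q.ξ i ω) ∧ IsGenericOn θ (fun i => Q.ξ i ω) Set.univ ∧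
      (∀ i, 0 ≤ Q.XR i ω) ∧ ∀ a b, IsLocalSystem θ (fun i => Q.ξ i ω) (fun i => Q.XR i ω)
        (fun i => Q.ZR i ω) (Q.A ω) (Q.B ω) a b := by
  have := hν.prob
  filter_upwards [Q.isIID.ae_hasRuns hνc, Q.isIID.ae_isGenericOn hν θ, Q.XL_rec, Q.XR_rec,
    Q.A_rule, Q.ZR_rec, Q.B_max, Q.B_tie] with ω h1 h2 h3 h4 h5 h6 h7 h8
  have hA := A_step_of_rule hc (XL := fun i => Q.XL i ω) (XR := fun i => Q.XR i ω) h3 h4 h1 h2 h5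
  refine ⟨h1, h2, fun i => (backward_form' hc h4 h1 h2 i).2.1, fun a b =>
    ⟨fun i _ _ => h4 i, fun i _ _ => (hA i).1, fun i _ _ => (hA i).2, fun i _ _ => h6 i,
      fun i _ _ => ⟨fun h => ?_, fun h => ?_⟩⟩⟩
  · by_contra hlt
    have := relBenefit_lt_iff (zL := Q.ZL i ω) (x := fun i => Q.ξ i ω) (i := i).2 (not_le.1 hlt)
    have h9 := h7 i (i ∈ Q.B ω) False
    rw [eq_true h] at h9
    exact absurd h9 (not_le.2 this)
  · by_contra hn
    have := (relBenefit_lt_iff (x := fun i => Q.ξ i ω)).1 (h8 i hn)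
    exact absurd h (not_le.2 this)

end StationaryQuintuple

/-! ### Existence of the stationary quintuple process -/

section Existence

variable {c θ : ℝ} {x : ℤ → ℝ}

/-- The benefits of taking both items, only the left or only the right are `XL + XR` minus the cost,
minus `XR` and minus `XL`, respectively. The decisions are optimal for each pair by
`relBenefit_le_of_step`, so a strict minimum among the three deductions identifies them. -/
theorem limA_rule (hc : c < 1 / 2) (hc0 : 0 ≤ c) (hr : HasRuns c x)
    (hg : IsGenericOn θ x Set.univ) (i : ℤ) :
    (x i < min (limXL x i) (limXR x (i + 1)) → i ∈ limA x ∧ i + 1 ∈ limA x) ∧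
    (limXR x (i + 1) < min (limXL x i) (x i) → i ∈ limA x ∧ i + 1 ∉ limA x) ∧
    (limXL x i < min (limXR x (i + 1)) (x i) → i ∉ limA x ∧ i + 1 ∈ limA x) := by
  have hx : ∀ i, 0 < x i := fun i => hg.pos i trivial
  have hL := limXL_succ hc hr
  have hR := limXR_eq hc hr
  have hL0 := fun i => (forward_form hc hL hr hg i).2.1
  have hR0 := fun i => (backward_form' hc hR hr hg i).2.1
  have h := relBenefit_le_of_step (S := limA x) (zL := limXL x) (zR := limXR x) (w := fun _ => 1) (fun i => (hx i).le) hr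
    (fun i => by rw [hL, min_form_eq (hL0 i) (hx i)])
    (fun i => by rw [hR, min_form_eq (hR0 (i + 1)) (hx i)])
    (fun i hi => ⟨?_, ?_⟩) (fun i hi => ((mem_limA_succ hc hc0 hr i).1 hi).le)
    (fun i hi => not_lt.1 (mt (mem_limA_succ hc hc0 hr i).2 hi)) i
  · have a1 := h True True
    have a2 := h True False
    have a3 := h False True
    have h1 := hx i
    have h2 := hL0 i
    have h3 := hR0 (i + 1)
    simp only [lt_min_iff]
    refine ⟨fun h => ?_, fun h => ?_, fun h => ?_⟩ <;>
      by_cases hp : i ∈ limA x <;> by_cases hq : i + 1 ∈ limA x <;>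
      simp [relBenefit, hp, hq] at a1 a2 a3 ⊢ <;> linarith
  · rw [hL]; exact lt_max_of_lt_right (by linarith)
  · rw [hR]; exact lt_max_of_lt_right (by linarith)

theorem limB_max (hθ : 0 < θ) (hc : c + θ < 1 / 2) (hc0 : 0 ≤ c) (hr : HasRuns c x)
    (hx : ∀ i, 0 ≤ x i) (i : ℤ) (p q : Prop) :
    relBenefit (limZL θ x i) (x i) (limZR θ x (i + 1)) p q ≤
      relBenefit (limZL θ x i) (x i) (limZR θ x (i + 1)) (i ∈ limB θ x) (i + 1 ∈ limB θ x) := by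
  have hL := limZL_succ hθ hc hc0 hr
  have hR := limZR_eq hθ hc hc0 hr
  refine relBenefit_le_of_step (w := fun i => 1 + θ * signJ (limA x) i) hx hr
    (fun i => by rw [hL]; ring) (fun i => by rw [hR]; ring)
    (fun i hi => ⟨modified_gt hθ hc hi (neg_mul_signJ_le hθ _ _) (hL i) hc0,
      modified_gt hθ hc hi (neg_mul_signJ_le hθ _ _) (hR i) hc0⟩)
    (fun i hi => (mem_limB_succ hθ hc hc0 hr i).1 hi)
    (fun i hi => (not_le.1 (mt (mem_limB_succ hθ hc hc0 hr i).2 hi)).le) i p q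

end Existence

/-- The canonical solution on the product space is a measurable shift-equivariant function of the
costs, so stationarity is inherited from the shift invariance of the product measure. -/
theorem IsPosDiffuse.nonempty_stationaryQuintuple {ν : Measure ℝ} (hν : IsPosDiffuse ν) {c θ : ℝ}
    (hθ : 0 < θ) (hc : c + θ < 1 / 2) (hc0 : 0 ≤ c) (hνc : 0 < ν (Set.Iic c)) :
    Nonempty (StationaryQuintuple.{0} ν θ) := by
  have := hν.prob
  set P : Measure (ℤ → ℝ) := Measure.infinitePi fun _ => ν with hP
  have hiid : IsIID P ν (fun (i : ℤ) (x : ℤ → ℝ) => x i) := isIID_infinitePi ℤ ν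
  have hruns : ∀ᵐ x ∂P, HasRuns c x := hiid.ae_hasRuns hνc
  have hgen : ∀ᵐ x ∂P, IsGenericOn θ x Set.univ := hiid.ae_isGenericOn hν θ
  have hc2 : c < 1 / 2 := by linarith
  have hshift : P.map (fun x (i : ℤ) => x (i + 1)) = P :=
    (hiid.precomp (f := fun i : ℤ => i + 1) (add_left_injective 1)).map_eq_infinitePi
  let Ψ : (ℤ → ℝ) → ℤ → ℝ × ℝ × ℝ × ℝ × ℝ := fun x i =>
    (limZL θ x i, limXL x i, x i, limXR x (i + 1), limZR θ x (i + 1))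
  have hΨ : Measurable Ψ := measurable_pi_lambda _ fun i =>
    (measurable_limZL θ i).prodMk ((measurable_limXL i).prodMk ((measurable_pi_apply i).prodMk
      ((measurable_limXR (i + 1)).prodMk (measurable_limZR θ (i + 1)))))
  refine ⟨{
    Ω := ℤ → ℝ
    P := P
    ZL := fun i x => limZL θ x i
    XL := fun i x => limXL x i
    ξ := fun i x => x i
    XR := fun i x => limXR x i
    ZR := fun i x => limZR θ x i
    A := limA
    B := limB θ
    measurable_ZL := measurable_limZL θ
    measurable_XL := measurable_limXL
    measurable_ξ := measurable_pi_apply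
    measurable_XR := measurable_limXR
    measurable_ZR := measurable_limZR θ
    measurable_A := measurableSet_limA
    measurable_B := measurableSet_limB θ
    stationary := ?_
    indep_ξ := hiid.indep
    law_ξ := hiid.law
    XL_rec := hruns.mono fun x hr => limXL_succ hc2 hr
    XR_rec := hruns.mono fun x hr => limXR_eq hc2 hr
    A_rule := (hruns.and hgen).mono fun x hx => limA_rule hc2 hc0 hx.1 hx.2
    ZL_rec := hruns.mono fun x hr => limZL_succ hθ hc hc0 hr
    ZR_rec := hruns.mono fun x hr => limZR_eq hθ hc hc0 hr
    B_max := (hruns.and hgen).mono fun x hx =>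
      limB_max hθ hc hc0 hx.1 fun i => (hx.2.pos i trivial).le
    B_tie := hruns.mono fun x hr i hi =>
      relBenefit_lt_iff.2 (not_le.1 (mt (mem_limB_succ hθ hc hc0 hr i).2 hi)) }⟩
  change P.map Ψ = P.map _
  conv_lhs => rw [← hshift]
  rw [Measure.map_map hΨ (measurable_pi_lambda _ fun i => measurable_pi_apply _)]
  congr 1
  ext1 x
  funext i
  simp only [Function.comp_apply, Ψ, limZL_shift, limXL_shift, limXR_shift, limZR_shift]

/-! ### Local functionals of costs and decisions -/

/-- A function of the cost and the four decisions at the pair `(i, i + 1)`. -/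
def localTerm (F : ℝ → Prop → Prop → Prop → Prop → ℝ) (x : ℤ → ℝ) (A B : Set ℤ) (i : ℤ) : ℝ :=
  F (x i) (i ∈ A) (i + 1 ∈ A) (i ∈ B) (i + 1 ∈ B)

theorem measurable_localTerm {F : ℝ → Prop → Prop → Prop → Prop → ℝ}
    (hF : ∀ p q r s, Measurable fun t => F t p q r s) {X : Type*} [MeasurableSpace X]
    {x : X → ℤ → ℝ} {A B : X → Set ℤ} (hx : ∀ i, Measurable fun a => x a i)
    (hA : ∀ i, MeasurableSet {a | i ∈ A a}) (hB : ∀ i, MeasurableSet {a | i ∈ B a}) (i : ℤ) :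
    Measurable fun a => localTerm F (x a) (A a) (B a) i := by
  -- The decisions range over a countable space, so measurability in the cost for fixed decisions
  -- suffices.
  have h : Measurable fun p : ℝ × Prop × Prop × Prop × Prop =>
      F p.1 p.2.1 p.2.2.1 p.2.2.2.1 p.2.2.2.2 :=
    measurable_from_prod_countable_left fun p => hF p.1 p.2.1 p.2.2.1 p.2.2.2
  exact h.comp ((hx i).prodMk ((measurableSet_setOfPred.1 (hA i)).prodMk
    ((measurableSet_setOfPred.1 (hA (i + 1))).prodMk ((measurableSet_setOfPred.1 (hB i)).prodMk
      (measurableSet_setOfPred.1 (hB (i + 1)))))))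

/-- The window contains a run on either side of the pair `(0, 1)`. -/
def IsGoodWindow (c : ℝ) (m : ℕ) (x : ℤ → ℝ) : Prop :=
  (∃ s : ℤ, -m ≤ s ∧ s ≤ -1 ∧ IsRun c x s) ∧ ∃ t : ℤ, 1 ≤ t ∧ t + 1 ≤ m ∧ IsRun c x t

/-- The extension by the constant `c` of costs given on `{-m,…,m}`. -/
def windowExt (c : ℝ) (m : ℕ) (v : Fin (2 * m + 1) → ℝ) (k : ℤ) : ℝ :=
  if h : 0 ≤ k + m ∧ (k + m).toNat < 2 * m + 1 then v ⟨(k + m).toNat, h.2⟩ else c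

theorem measurable_windowExt (c : ℝ) (m : ℕ) (k : ℤ) :
    Measurable fun v => windowExt c m v k := by
  unfold windowExt
  split_ifs
  · exact measurable_pi_apply _
  · exact measurable_const

/-- Padding by the constant `c` creates runs everywhere outside the window, so the canonical
recursions hold for every padded window. -/
theorem hasRuns_windowExt (c : ℝ) (m : ℕ) (v : Fin (2 * m + 1) → ℝ) :
    HasRuns c (windowExt c m v) := by
  have h : ∀ k : ℤ, k < -m ∨ m < k → windowExt c m v k ≤ c := by
    intro k hk
    rw [windowExt, dif_neg (by lia)]
  exact ⟨fun i => ⟨min i (-m - 2), by lia, h _ (by lia), h _ (by lia)⟩,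
    fun i => ⟨max i (m + 1), by lia, h _ (by lia), h _ (by lia)⟩⟩

theorem windowExt_apply (c : ℝ) (m : ℕ) (x : ℤ → ℝ) {k : ℤ} (hk : -m ≤ k) (hk' : k ≤ m) :
    windowExt c m (fun a => x (a - m)) k = x k := by
  rw [windowExt, dif_pos (by lia)]
  congr 1
  simp only
  lia

theorem measurableSet_isGoodWindow (c : ℝ) (m : ℕ) : MeasurableSet {x | IsGoodWindow c m x} := by
  have hrun : ∀ s, Measurable fun x : ℤ → ℝ => IsRun c x s := fun s =>
    (measurableSet_setOfPred.1 (measurableSet_le (measurable_pi_apply s) measurable_const)).and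
      (measurableSet_setOfPred.1 (measurableSet_le (measurable_pi_apply (s + 1)) measurable_const))
  refine measurableSet_setOfPred.2 (Measurable.and ?_ ?_) <;>
  exact Measurable.exists fun s => measurable_const.and (measurable_const.and (hrun s))

theorem IsGoodWindow.congr {c : ℝ} {m : ℕ} {x x' : ℤ → ℝ}
    (h : ∀ i ∈ Set.Ico (-m : ℤ) (m + 1), x i = x' i) (hg : IsGoodWindow c m x) :
    IsGoodWindow c m x' := by
  obtain ⟨⟨s, h1, h2, h3, h4⟩, t, h5, h6, h7, h8⟩ := hg
  refine ⟨⟨s, h1, h2, ?_, ?_⟩, t, h5, h6, ?_, ?_⟩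
  · rwa [← h s ⟨h1, by lia⟩]
  · rwa [← h (s + 1) ⟨by lia, by lia⟩]
  · rwa [← h t ⟨by lia, by lia⟩]
  · rwa [← h (t + 1) ⟨by lia, by lia⟩]

theorem HasRuns.eventually_isGoodWindow {c : ℝ} {x : ℤ → ℝ} (h : HasRuns c x) :
    ∀ᶠ m in atTop, IsGoodWindow c m x := by
  obtain ⟨s, hs, hs'⟩ := h.left (-1)
  obtain ⟨t, ht, ht'⟩ := h.right 1
  filter_upwards [eventually_ge_atTop (max (-s) (t + 1)).toNat] with m hm
  exact ⟨⟨s, by lia, hs, hs'⟩, t, ht, by lia, ht'⟩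

/-- In a good window, the decisions at the central pair are those of the canonical solution. -/
theorem localTerm_eq_of_isGoodWindow (F : ℝ → Prop → Prop → Prop → Prop → ℝ) {θ c : ℝ}
    (hθ : 0 < θ) (hc : c + θ < 1 / 2) (hc0 : 0 ≤ c) {m : ℕ} {x x' XR ZR : ℤ → ℝ} {A B : Set ℤ}
    (h : IsLocalSystem θ x XR ZR A B (-m) (m + 1))
    (hx : ∀ i ∈ Set.Ico (-m : ℤ) (m + 1), x i = x' i) (hr : HasRuns c x')
    (hg : IsGenericOn θ x (Set.Ico (-m : ℤ) (m + 1))) (hw : IsGoodWindow c m x) :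
    localTerm F x A B 0 = localTerm F x' (limA x') (limB θ x') 0 := by
  obtain ⟨⟨s, hs1, hs2, hs⟩, t, ht1, ht2, ht⟩ := hw
  have key := fun i => h.agree hθ hc (limIsLocalSystem hθ hc hc0 hr (-m) (m + 1)) hx hg hs1
    (by lia) (by lia) hs ht (i := i)
  have k0 := key 0 (by lia) (by lia)
  have k1 := key (0 + 1) (by lia) (by lia)
  simp only [localTerm, hx 0 ⟨by lia, by lia⟩, k0.1, k0.2, k1.1, k1.2]

/-- The canonical value of a local functional, truncated at `C`, as a function of the window. -/
noncomputable def windowTerm (F : ℝ → Prop → Prop → Prop → Prop → ℝ) (θ c C : ℝ) (m : ℕ)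
    (v : Fin (2 * m + 1) → ℝ) : ℝ :=
  max (-C) (min C (localTerm F (windowExt c m v) (limA (windowExt c m v))
    (limB θ (windowExt c m v)) 0))

open Classical in
/-- The indicator of the windows which are not good. -/
noncomputable def badWindow (c : ℝ) (m : ℕ) (v : Fin (2 * m + 1) → ℝ) : ℝ :=
  if IsGoodWindow c m (windowExt c m v) then 0 else 1

theorem measurable_windowTerm {F : ℝ → Prop → Prop → Prop → Prop → ℝ}
    (hF : ∀ p q r s, Measurable fun t => F t p q r s) (θ c C : ℝ) (m : ℕ) :
    Measurable (windowTerm F θ c C m) := by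
  have h := measurable_localTerm hF (x := fun x : ℤ → ℝ => x) (A := limA) (B := limB θ)
    measurable_pi_apply measurableSet_limA (measurableSet_limB θ) 0
  exact measurable_const.max (measurable_const.min
    (h.comp (measurable_pi_lambda _ (measurable_windowExt c m))))

theorem measurable_badWindow (c : ℝ) (m : ℕ) : Measurable (badWindow c m) := by
  classical
  unfold badWindow
  exact Measurable.ite (measurable_pi_lambda _ (measurable_windowExt c m)
    (measurableSet_isGoodWindow c m)) measurable_const measurable_const

theorem abs_windowTerm_le {C : ℝ} (hC : 0 ≤ C) (F : ℝ → Prop → Prop → Prop → Prop → ℝ) (θ c : ℝ)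
    (m : ℕ) (v : Fin (2 * m + 1) → ℝ) : |windowTerm F θ c C m v| ≤ C :=
  abs_le.2 ⟨le_max_left _ _, max_le (by linarith) (min_le_left _ _)⟩

theorem badWindow_nonneg (c : ℝ) (m : ℕ) (v : Fin (2 * m + 1) → ℝ) : 0 ≤ badWindow c m v := by
  unfold badWindow; split_ifs <;> norm_num

theorem abs_badWindow_le (c : ℝ) (m : ℕ) (v : Fin (2 * m + 1) → ℝ) : |badWindow c m v| ≤ 1 := by
  unfold badWindow; split_ifs <;> norm_num

theorem windowTerm_eq (F : ℝ → Prop → Prop → Prop → Prop → ℝ) {θ c C : ℝ}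
    (hθ : 0 < θ) (hc : c + θ < 1 / 2) (hc0 : 0 ≤ c) {m : ℕ} {x XR ZR : ℤ → ℝ} {A B : Set ℤ}
    (h : IsLocalSystem θ x XR ZR A B (-m) (m + 1))
    (hg : IsGenericOn θ x (Set.Ico (-m : ℤ) (m + 1))) (hw : IsGoodWindow c m x)
    (hC : |localTerm F x A B 0| ≤ C) :
    windowTerm F θ c C m (fun a => x (a - m)) = localTerm F x A B 0 := by
  rw [windowTerm, ← localTerm_eq_of_isGoodWindow F hθ hc hc0 h
    (fun i hi => (windowExt_apply c m x hi.1 (by have := hi.2; lia)).symm)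
    (hasRuns_windowExt c m _) hg hw, min_eq_right (abs_le.1 hC).2, max_eq_right (abs_le.1 hC).1]

theorem badWindow_eq {c : ℝ} {m : ℕ} {x : ℤ → ℝ} (hw : IsGoodWindow c m x) :
    badWindow c m (fun a => x (a - m)) = 0 := by
  rw [badWindow, if_pos]
  exact hw.congr fun i hi => (windowExt_apply c m x hi.1 (by have := hi.2; lia)).symm

theorem badWindow_eq_one {c : ℝ} {m : ℕ} {x : ℤ → ℝ} (hw : ¬ IsGoodWindow c m x) :
    badWindow c m (fun a => x (a - m)) = 1 := by
  rw [badWindow, if_neg]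
  exact fun h => hw (h.congr fun i hi => windowExt_apply c m x hi.1 (by have := hi.2; lia))

/-! ### Approximation by windows -/

section Limit

variable {ν : Measure ℝ} {θ c C : ℝ} {F : ℝ → Prop → Prop → Prop → Prop → ℝ}

/-- Almost surely every sufficiently long window is good, and then the window term equals the local
term of `Q`; dominated convergence does the rest. The integrals over windows do not involve `Q`,
hence neither does the limit. -/
theorem StationaryQuintuple.tendsto_window (Q : StationaryQuintuple.{u} ν θ) (hν : IsPosDiffuse ν)
    (hθ : 0 < θ) (hc : c + θ < 1 / 2) (hc0 : 0 ≤ c) (hνc : 0 < ν (Set.Iic c))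
    (hF : ∀ p q r s, Measurable fun t => F t p q r s) (hC0 : 0 ≤ C)
    (hC : ∀ᵐ ω ∂Q.P, |localTerm F (fun i => Q.ξ i ω) (Q.A ω) (Q.B ω) 0| ≤ C) :
    Tendsto (fun m : ℕ => ∫ v, windowTerm F θ c C m v ∂Measure.pi fun _ => ν) atTop
      (𝓝 (∫ ω, localTerm F (fun i => Q.ξ i ω) (Q.A ω) (Q.B ω) 0 ∂Q.P)) ∧
    Tendsto (fun m : ℕ => ∫ v, badWindow c m v ∂Measure.pi fun _ => ν) atTop (𝓝 0) := by
  have hlaw : ∀ m : ℕ, Q.P.map (fun ω (a : Fin (2 * m + 1)) => Q.ξ ((a : ℤ) - m) ω) =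
      Measure.pi fun _ => ν := fun m =>
    (Q.isIID.precomp (f := fun a : Fin (2 * m + 1) => (a : ℤ) - m)
      fun a b hab => Fin.ext (by simpa using hab)).map_eq_pi
  have hmeas : ∀ m : ℕ, Measurable fun ω (a : Fin (2 * m + 1)) => Q.ξ ((a : ℤ) - m) ω := fun m =>
    measurable_pi_lambda _ fun a => Q.measurable_ξ _
  have hsys := Q.ae_isLocalSystem hν (c := c) (by linarith) hνc
  constructor
  · have : ∀ m : ℕ, ∫ v, windowTerm F θ c C m v ∂Measure.pi (fun _ => ν) =
        ∫ ω, windowTerm F θ c C m (fun a => Q.ξ ((a : ℤ) - m) ω) ∂Q.P := fun m => by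
      rw [← hlaw m, integral_map (hmeas m).aemeasurable
        (measurable_windowTerm hF θ c C m).aestronglyMeasurable]
    simp only [this]
    refine tendsto_integral_of_dominated_convergence (fun _ => C)
      (fun m => ((measurable_windowTerm hF θ c C m).comp (hmeas m)).aestronglyMeasurable)
      (integrable_const C) (fun m => Eventually.of_forall fun ω => abs_windowTerm_le hC0 F θ c m _)
      ?_
    filter_upwards [hsys, hC] with ω hω hCω
    refine tendsto_const_nhds.congr' ?_
    filter_upwards [hω.1.eventually_isGoodWindow] with m hm
    exact (windowTerm_eq F hθ hc hc0 (hω.2.2.2 _ _) (hω.2.1.mono (Set.subset_univ _)) hm hCω).symm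
  · have : ∀ m : ℕ, ∫ v, badWindow c m v ∂Measure.pi (fun _ => ν) =
        ∫ ω, badWindow c m (fun a => Q.ξ ((a : ℤ) - m) ω) ∂Q.P := fun m => by
      rw [← hlaw m, integral_map (hmeas m).aemeasurable
        (measurable_badWindow c m).aestronglyMeasurable]
    simp only [this]
    have h0 : (0 : ℝ) = ∫ _, (0 : ℝ) ∂Q.P := by simp
    rw [h0]
    refine tendsto_integral_of_dominated_convergence (fun _ => 1)
      (fun m => ((measurable_badWindow c m).comp (hmeas m)).aestronglyMeasurable)
      (integrable_const 1) (fun m => Eventually.of_forall fun ω => abs_badWindow_le c m _) ?_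
    filter_upwards [hsys] with ω hω
    refine tendsto_const_nhds.congr' ?_
    filter_upwards [hω.1.eventually_isGoodWindow] with m hm
    exact (badWindow_eq hm).symm

theorem isGenericOn_of_succ {x : ℕ → ℝ} (h : IsGenericOn θ (fun i => x (i + 1)) Set.univ) :
    IsGenericOn θ x (Set.Ici 1) := by
  have := h.comp (f := fun i : ℕ => i - 1) (K := Set.Ici 1) (fun _ _ => trivial)
    fun i hi j hj hij => by
      rw [Set.mem_Ici] at hi hj
      simp only at hij
      lia
  exact this.congr fun i hi => by simp only [Nat.sub_add_cancel (Set.mem_Ici.1 hi)]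

theorem abs_sum_le_card_mul {s : Finset ℕ} {f : ℕ → ℝ} (h : ∀ i ∈ s, |f i| ≤ C) :
    |∑ i ∈ s, f i| ≤ s.card * C := by
  refine (Finset.abs_sum_le_sum_abs _ _).trans ((Finset.sum_le_card_nsmul _ _ C h).trans ?_)
  rw [nsmul_eq_mul]

/-- The finite sums are close to the sums over windows. -/
theorem abs_sum_sub_window_le (hθ : 0 < θ) (hc : c + θ < 1 / 2) (hc0 : 0 ≤ c) (hC0 : 0 ≤ C)
    {x : ℕ → ℝ} (hg : IsGenericOn θ x (Set.Ici 1)) {n m : ℕ} (hn : 2 * m + 1 ≤ n)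
    {XR ZR : ℤ → ℝ} {A B : Set ℤ} (h : IsLocalSystem θ (extendInt x) XR ZR A B 1 n)
    (hC : ∀ i : ℕ, 1 ≤ i → i < n → |localTerm F (extendInt x) A B i| ≤ C) :
    |∑ i ∈ Finset.Ico 1 n, localTerm F (extendInt x) A B i -
      ∑ j ∈ Finset.range n, windowTerm F θ c C m fun a => x (j + a + 1)| ≤
    2 * C * ∑ j ∈ Finset.range n, badWindow c m (fun a => x (j + a + 1)) + (4 * m + 1) * C := by
  obtain ⟨N, rfl⟩ := Nat.exists_eq_add_of_le' hn
  set Y : ℕ → ℝ := fun i => localTerm F (extendInt x) A B i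
  set φ : ℕ → ℝ := fun j => windowTerm F θ c C m fun a => x (j + a + 1)
  set b : ℕ → ℝ := fun j => badWindow c m fun a => x (j + a + 1)
  have hφ : ∀ j, |φ j| ≤ C := fun j => abs_windowTerm_le hC0 F θ c m _
  have hb : ∀ j, 0 ≤ b j := fun j => badWindow_nonneg c m _
  -- The window of the costs `j + 1, …, j + 2 * m + 1` is centred at `m + 1 + j`; for `j < N` it
  -- stays below `n`.
  have hpt : ∀ j, j < N → |Y (m + 1 + j) - φ j| ≤ 2 * C * b j := by
    intro j hj
    set x' : ℤ → ℝ := fun k => extendInt x (k + (m + 1 + j : ℕ)) with hx'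
    have hv : (fun a : Fin (2 * m + 1) => x (j + a + 1)) = fun a : Fin (2 * m + 1) => x' ((a : ℤ) - m) := by
      funext a
      simp only [hx', extendInt]
      congr 1
      lia
    have hsys : IsLocalSystem θ x' _ _ _ _ (-m) (m + 1) :=
      (h.mono (a' := -m + (m + 1 + j : ℕ)) (b' := m + 1 + (m + 1 + j : ℕ)) (by lia)
        (by lia)).shift
    have hY : localTerm F x' {i | i + ((m + 1 + j : ℕ) : ℤ) ∈ A} {i | i + ((m + 1 + j : ℕ) : ℤ) ∈ B}
        0 = Y (m + 1 + j) := by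
      simp only [localTerm, Y, hx', Set.mem_ofPred_eq, zero_add, add_comm (1 : ℤ)]
    have hgen : IsGenericOn θ x' (Set.Ico (-m : ℤ) (m + 1)) := by
      refine hg.comp (f := fun k : ℤ => (k + (m + 1 + j : ℕ)).toNat) (fun k hk => ?_)
        fun k hk l hl hkl => ?_
      · have := hk.1
        change 1 ≤ (k + (m + 1 + j : ℕ)).toNat
        lia
      · have := hk.1
        have := hl.1
        simp only at hkl
        lia
    have hYC := hC (m + 1 + j) (by lia) (by lia)
    by_cases hw : IsGoodWindow c m x'
    · have h1 : φ j = Y (m + 1 + j) := by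
        simp only [φ, hv]
        rw [← hY]
        exact windowTerm_eq F hθ hc hc0 hsys hgen hw (by rw [hY]; exact hYC)
      rw [h1, sub_self, abs_zero]
      exact mul_nonneg (by linarith) (hb j)
    · have h1 : b j = 1 := by
        simp only [b, hv]
        exact badWindow_eq_one hw
      rw [h1, mul_one]
      have := abs_sub (Y (m + 1 + j)) (φ j)
      linarith [hφ j]
  have e1 : ∑ i ∈ Finset.Ico 1 (N + (2 * m + 1)), Y i = ∑ i ∈ Finset.Ico 1 (m + 1), Y i +
      (∑ j ∈ Finset.range N, Y (m + 1 + j) + ∑ i ∈ Finset.Ico (m + 1 + N) (N + (2 * m + 1)), Y i) := by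
    rw [← Finset.sum_Ico_consecutive Y (show 1 ≤ m + 1 by lia)
        (show m + 1 ≤ N + (2 * m + 1) by lia),
      ← Finset.sum_Ico_consecutive Y (show m + 1 ≤ m + 1 + N by lia)
        (show m + 1 + N ≤ N + (2 * m + 1) by lia), Finset.sum_Ico_eq_sum_range Y (m + 1),
      Nat.add_sub_cancel_left]
  have e2 : ∀ f : ℕ → ℝ, ∑ j ∈ Finset.range (N + (2 * m + 1)), f j =
      ∑ j ∈ Finset.range N, f j + ∑ j ∈ Finset.range (2 * m + 1), f (N + j) :=
    fun f => Finset.sum_range_add f _ _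
  -- Boundary errors: `m` terms at each end and the last `2 * m + 1` windows, together `4 * m + 1`.
  have b1 : |∑ i ∈ Finset.Ico 1 (m + 1), Y i| ≤ m * C := by
    refine (abs_sum_le_card_mul (C := C) fun i hi => ?_).trans (by simp)
    rw [Finset.mem_Ico] at hi
    exact hC i hi.1 (by lia)
  have b2 : |∑ i ∈ Finset.Ico (m + 1 + N) (N + (2 * m + 1)), Y i| ≤ m * C := by
    refine (abs_sum_le_card_mul (C := C) fun i hi => ?_).trans (le_of_eq ?_)
    · rw [Finset.mem_Ico] at hi
      exact hC i (by lia) hi.2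
    · rw [Nat.card_Ico, show N + (2 * m + 1) - (m + 1 + N) = m by lia]
  have b3 : |∑ j ∈ Finset.range (2 * m + 1), φ (N + j)| ≤ (2 * m + 1) * C := by
    refine (abs_sum_le_card_mul fun i _ => hφ _).trans (le_of_eq ?_)
    rw [Finset.card_range]; push_cast; ring
  have b4 : |∑ j ∈ Finset.range N, Y (m + 1 + j) - ∑ j ∈ Finset.range N, φ j| ≤
      2 * C * ∑ j ∈ Finset.range N, b j := by
    rw [← Finset.sum_sub_distrib, Finset.mul_sum]
    exact (Finset.abs_sum_le_sum_abs _ _).trans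
      (Finset.sum_le_sum fun j hj => hpt j (Finset.mem_range.1 hj))
  have b5 : 0 ≤ 2 * C * ∑ j ∈ Finset.range (2 * m + 1), b (N + j) :=
    mul_nonneg (by linarith) (Finset.sum_nonneg fun j _ => hb _)
  rw [e1, e2 φ, e2 b]
  rw [abs_le] at *
  constructor <;> linarith [b1.1, b1.2, b2.1, b2.2, b3.1, b3.2, b4.1, b4.2]

/-- The window size `m` is fixed first, making `L m` close to `l` and `C * p m` small; only then
does `n` grow. -/
theorem tendsto_of_window_approx {f L : ℕ → ℝ} {l C : ℝ} {a b : ℕ → ℕ → ℝ} {p : ℕ → ℝ}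
    (ha : ∀ m, Tendsto (a m) atTop (𝓝 (L m))) (hb : ∀ m, Tendsto (b m) atTop (𝓝 (p m)))
    (hL : Tendsto L atTop (𝓝 l)) (hp : Tendsto p atTop (𝓝 0)) {K : ℕ → ℝ}
    (h : ∀ m, ∀ᶠ n : ℕ in atTop, |f n - a m n| ≤ C * b m n + K m / n) :
    Tendsto f atTop (𝓝 l) := by
  rw [Metric.tendsto_nhds]
  intro ε hε
  have hCp : Tendsto (fun m => C * p m) atTop (𝓝 0) := by simpa using hp.const_mul C
  obtain ⟨m, h1, h2⟩ := ((Metric.tendsto_nhds.1 hL (ε / 4) (by linarith)).and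
    (hCp.eventually_lt_const (show (0 : ℝ) < ε / 4 by linarith))).exists
  have hK : Tendsto (fun n : ℕ => C * b m n + K m / n) atTop (𝓝 (C * p m + 0)) :=
    ((hb m).const_mul C).add (tendsto_const_nhds.div_atTop tendsto_natCast_atTop_atTop)
  filter_upwards [h m, hK.eventually_lt_const (show C * p m + 0 < ε / 4 + ε / 4 by linarith),
    Metric.tendsto_nhds.1 (ha m) (ε / 4) (by linarith)] with n h3 h4 h5
  rw [Real.dist_eq, abs_lt] at *
  rw [abs_le] at h3
  constructor <;> linarith [h3.1, h3.2, h1.1, h1.2, h5.1, h5.2]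

/-- The exceptional null set depends on the costs only: the sets and backward values are quantified
inside, so they may later be chosen separately for each `ω`, without measurability. The slack `1`
absorbs the last item, which begins no pair. -/
theorem StationaryQuintuple.ae_tendsto (Q : StationaryQuintuple.{v} ν θ) (hν : IsPosDiffuse ν)
    (hθ : 0 < θ) (hc : c + θ < 1 / 2) (hc0 : 0 ≤ c) (hνc : 0 < ν (Set.Iic c))
    (hF : ∀ p q r s, Measurable fun t => F t p q r s) (hC0 : 0 ≤ C)
    (hC : ∀ᵐ ω ∂Q.P, |localTerm F (fun i => Q.ξ i ω) (Q.A ω) (Q.B ω) 0| ≤ C)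
    {Ω : Type u} [MeasurableSpace Ω] {P : Measure Ω} [IsProbabilityMeasure P] {ξ : ℕ → Ω → ℝ}
    (hξ : IsIID P ν fun i => ξ (i + 1)) :
    ∀ᵐ ω ∂P, ∀ (A B : ℕ → Set ℤ) (XR ZR : ℕ → ℤ → ℝ) (T : ℕ → ℝ),
      (∀ n, 1 ≤ n →
        IsLocalSystem θ (extendInt fun i => ξ i ω) (XR n) (ZR n) (A n) (B n) 1 n) →
      (∀ n i : ℕ, 1 ≤ i → i < n →
        |localTerm F (extendInt fun i => ξ i ω) (A n) (B n) i| ≤ C) →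
      (∀ n, 1 ≤ n → |T n - ∑ i ∈ Finset.Ico 1 n,
        localTerm F (extendInt fun i => ξ i ω) (A n) (B n) i| ≤ 1) →
      Tendsto (fun n : ℕ => (n : ℝ)⁻¹ * T n) atTop
        (𝓝 (∫ ω, localTerm F (fun i => Q.ξ i ω) (Q.A ω) (Q.B ω) 0 ∂Q.P)) := by
  obtain ⟨hL, hp⟩ := Q.tendsto_window hν hθ hc hc0 hνc hF hC0 hC
  have h1 := ae_all_iff.2 fun m : ℕ => hξ.window_lln (show 0 < 2 * m + 1 by lia)
    (measurable_windowTerm hF θ c C m) (abs_windowTerm_le hC0 F θ c m)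
  have h2 := ae_all_iff.2 fun m : ℕ => hξ.window_lln (show 0 < 2 * m + 1 by lia)
    (measurable_badWindow c m) (abs_badWindow_le c m)
  filter_upwards [h1, h2, hξ.ae_isGenericOn hν θ] with ω h1 h2 hg A B XR ZR T hsys hbd hT
  have hg' := isGenericOn_of_succ (x := fun i => ξ i ω) hg
  refine tendsto_of_window_approx (C := 2 * C) (K := fun m => (4 * m + 1) * C + 1)
    h1 h2 hL hp fun m => ?_
  filter_upwards [eventually_ge_atTop (2 * m + 1)] with n hn
  have hn1 : 1 ≤ n := by lia
  have hn0 : (0 : ℝ) < n := by exact_mod_cast hn1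
  have key := abs_sum_sub_window_le hθ hc hc0 hC0 hg' hn (hsys n hn1) (hbd n)
  have key2 := hT n hn1
  rw [inv_mul_eq_div, ← sub_div, abs_div, abs_of_pos hn0, ← mul_div_assoc, ← add_div]
  refine div_le_div_of_nonneg_right ?_ hn0.le
  rw [abs_le] at *
  constructor <;> linarith [key.1, key.2, key2.1, key2.2]

end Limit

/-! ### Distance and loss as sums of local terms -/

open Classical in
/-- The indicator that item `i` is in exactly one of the two sets. -/
noncomputable def diffTerm (_ : ℝ) (p _ r _ : Prop) : ℝ := if ¬ (p ↔ r) then 1 else 0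

open Classical in
/-- The contribution of the pair `(i, i + 1)` to the difference of the benefits. -/
noncomputable def lossTerm (t : ℝ) (p q r s : Prop) : ℝ :=
  ((if p then 1 else 0) - if p ∧ q then t else 0) - ((if r then 1 else 0) - if r ∧ s then t else 0)

theorem measurable_diffTerm (p q r s : Prop) : Measurable fun t => diffTerm t p q r s :=
  measurable_const

theorem measurable_lossTerm (p q r s : Prop) : Measurable fun t => lossTerm t p q r s := by
  unfold lossTerm
  split_ifs <;> fun_prop

theorem abs_diffTerm_le (t : ℝ) (p q r s : Prop) : |diffTerm t p q r s| ≤ 1 := by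
  unfold diffTerm; split_ifs <;> norm_num

theorem abs_lossTerm_le {t θ : ℝ} (ht : 0 ≤ t) (hθ : 0 ≤ θ) {p q r s : Prop}
    (h1 : p → q → t ≤ 1) (h2 : r → s → t ≤ 1 + θ) : |lossTerm t p q r s| ≤ 1 + θ := by
  classical
  have e1 : 0 ≤ (if p then 1 else 0) - (if p ∧ q then t else 0) ∧
      (if p then 1 else 0) - (if p ∧ q then t else 0) ≤ 1 := by
    by_cases hp : p <;> by_cases hq : q <;> simp [hp, hq]
    exact ⟨h1 hp hq, ht⟩
  have e2 : -θ ≤ (if r then 1 else 0) - (if r ∧ s then t else 0) ∧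
      (if r then 1 else 0) - (if r ∧ s then t else 0) ≤ 1 := by
    by_cases hr : r <;> by_cases hs : s <;> simp [hr, hs] <;> try linarith
    have := h2 hr hs
    constructor <;> linarith
  have e3 : lossTerm t p q r s = ((if p then 1 else 0) - (if p ∧ q then t else 0)) -
      ((if r then 1 else 0) - (if r ∧ s then t else 0)) := by
    unfold lossTerm; congr
  rw [e3, abs_le]
  constructor <;> linarith [e1.1, e1.2, e2.1, e2.2]

theorem abs_card_sub_sum_le {n : ℕ} (hn : 1 ≤ n) (x : ℤ → ℝ) {A B : Finset ℕ}
    (hA : A ⊆ Finset.Icc 1 n) (hB : B ⊆ Finset.Icc 1 n) :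
    |((symmDiff B A).card : ℝ) -
      ∑ i ∈ Finset.Ico 1 n, localTerm diffTerm x (intItems A) (intItems B) i| ≤ 1 := by
  have h : ((symmDiff B A).card : ℝ) =
      ∑ i ∈ Finset.Ico 1 (n + 1), localTerm diffTerm x (intItems A) (intItems B) i := by
    have e := sum_eq_sum_Icc (S := symmDiff B A) (n := n)
      ((Finset.symmDiff_subset_union).trans (Finset.union_subset hB hA)) (fun _ => 1)
    rw [Finset.sum_const, nsmul_eq_mul, mul_one] at e
    rw [e]
    refine Finset.sum_congr rfl fun i _ => ?_
    by_cases h1 : i ∈ A <;> by_cases h2 : i ∈ B <;>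
      simp [localTerm, diffTerm, mem_intItems, Finset.mem_symmDiff, h1, h2]
  rw [h, Finset.sum_Ico_succ_top hn, add_sub_cancel_left]
  exact abs_diffTerm_le _ _ _ _ _

theorem abs_benefit_sub_sum_le {n : ℕ} (hn : 1 ≤ n) (x : ℕ → ℝ) {A B : Finset ℕ}
    (hA : A ⊆ Finset.Icc 1 n) (hB : B ⊆ Finset.Icc 1 n) :
    |benefit n x A - benefit n x B -
      ∑ i ∈ Finset.Ico 1 n, localTerm lossTerm (extendInt x) (intItems A) (intItems B) i| ≤ 1 := by
  have hmem : ∀ (S : Finset ℕ) (i : ℕ), (i : ℤ) + 1 ∈ intItems S ↔ i + 1 ∈ S := fun S i => by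
    rw [mem_intItems, show ((i : ℤ) + 1).toNat = i + 1 by lia]
  have h : ∑ i ∈ Finset.Ico 1 n, localTerm lossTerm (extendInt x) (intItems A) (intItems B) i =
      (∑ i ∈ Finset.Ico 1 n, (if i ∈ A then (1 : ℝ) else 0) -
        ∑ i ∈ Finset.Ico 1 n, if i ∈ A ∧ i + 1 ∈ A then x i else 0) -
      (∑ i ∈ Finset.Ico 1 n, (if i ∈ B then (1 : ℝ) else 0) -
        ∑ i ∈ Finset.Ico 1 n, if i ∈ B ∧ i + 1 ∈ B then x i else 0) := by
    simp only [← Finset.sum_sub_distrib]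
    refine Finset.sum_congr rfl fun i _ => ?_
    by_cases h1 : i ∈ A <;> by_cases h2 : i ∈ B <;> by_cases h3 : i + 1 ∈ A <;>
      by_cases h4 : i + 1 ∈ B <;>
      simp [localTerm, lossTerm, hmem, mem_intItems, extendInt, h1, h2, h3, h4]
  rw [h, benefit_eq, benefit_eq, weightedBenefit, weightedBenefit, sum_eq_sum_Icc hA,
    sum_eq_sum_Icc hB, Finset.sum_Ico_succ_top hn, Finset.sum_Ico_succ_top hn, abs_le]
  by_cases h1 : n ∈ A <;> by_cases h2 : n ∈ B <;> simp only [h1, h2, if_true, if_false] <;>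
    constructor <;> linarith

theorem maxBenefit_eq {n : ℕ} {x : ℕ → ℝ} {A : Finset ℕ} (hA : IsOptimal n x A) :
    maxBenefit n x = benefit n x A :=
  le_antisymm (Finset.sup'_le _ _ fun T hT => hA.2 T (Finset.mem_powerset.1 hT))
    (Finset.le_sup' (benefit n x) (Finset.mem_powerset.2 hA.1))

namespace StationaryQuintuple

variable {ν : Measure ℝ} {θ c : ℝ} (Q : StationaryQuintuple.{u} ν θ)

theorem delta_eq : Q.delta =
    ∫ ω, localTerm diffTerm (fun i => Q.ξ i ω) (Q.A ω) (Q.B ω) 0 ∂Q.P := by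
  have hm := (Q.measurable_A 0).symmDiff (Q.measurable_B 0)
  rw [delta, ← integral_indicator_one hm]
  refine integral_congr_ae (Eventually.of_forall fun ω => ?_)
  by_cases h1 : (0 : ℤ) ∈ Q.A ω <;> by_cases h2 : (0 : ℤ) ∈ Q.B ω <;>
    simp [localTerm, diffTerm, Set.indicator, Set.mem_symmDiff, h1, h2]

/-- Bounded costs on the events where they are paid make the expectations in `epsilon` finite
without a moment assumption on `ν`. -/
theorem ae_cost_le (hν : IsPosDiffuse ν) (hc : c < 1 / 2) (hνc : 0 < ν (Set.Iic c)) (hθ : 0 < θ) :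
    ∀ᵐ ω ∂Q.P, 0 ≤ Q.ξ 0 ω ∧ ((0 : ℤ) ∈ Q.A ω → (1 : ℤ) ∈ Q.A ω → Q.ξ 0 ω ≤ 1) ∧
      ((0 : ℤ) ∈ Q.B ω → (1 : ℤ) ∈ Q.B ω → Q.ξ 0 ω ≤ 1 + θ) := by
  filter_upwards [Q.ae_isLocalSystem hν hc hνc] with ω hω
  have hpos : ∀ i, 0 ≤ Q.ξ i ω := fun i => (hω.2.1.pos i trivial).le
  have := (hω.2.2.2 0 2).cost_le hθ (i := 0) le_rfl (by lia) (fun j _ _ => hpos j) (hω.2.2.1 _)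
  rw [zero_add] at this
  exact ⟨hpos 0, this⟩

theorem integrable_indicator_cost {S : Q.Ω → Set ℤ} (hS : ∀ i, MeasurableSet {ω | i ∈ S ω}) {K : ℝ}
    (hK : 0 ≤ K)
    (h : ∀ᵐ ω ∂Q.P, 0 ≤ Q.ξ 0 ω ∧ ((0 : ℤ) ∈ S ω → (1 : ℤ) ∈ S ω → Q.ξ 0 ω ≤ K)) :
    Integrable (Set.indicator {ω | (0 : ℤ) ∈ S ω ∧ (1 : ℤ) ∈ S ω} (Q.ξ 0)) Q.P := by
  refine Integrable.of_bound (C := K)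
    ((Q.measurable_ξ 0).indicator ((hS 0).inter (hS 1))).aestronglyMeasurable ?_
  filter_upwards [h] with ω hω
  by_cases h1 : (0 : ℤ) ∈ S ω ∧ (1 : ℤ) ∈ S ω
  · rw [Set.indicator_of_mem (by exact h1), Real.norm_eq_abs, abs_of_nonneg hω.1]
    exact hω.2 h1.1 h1.2
  · rw [Set.indicator_of_notMem (by exact h1), norm_zero]
    exact hK

theorem integrable_indicator_one {s : Set Q.Ω} (hs : MeasurableSet s) :
    Integrable (Set.indicator s (1 : Q.Ω → ℝ)) Q.P :=
  (integrable_const (1 : ℝ)).indicator hs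

theorem meanBenefit_eq {S : Q.Ω → Set ℤ} (hS : ∀ i, MeasurableSet {ω | i ∈ S ω})
    (h : Integrable (Set.indicator {ω | (0 : ℤ) ∈ S ω ∧ (1 : ℤ) ∈ S ω} (Q.ξ 0)) Q.P) :
    Q.meanBenefit S = ∫ ω, (Set.indicator {ω | (0 : ℤ) ∈ S ω} 1 ω -
      Set.indicator {ω | (0 : ℤ) ∈ S ω ∧ (1 : ℤ) ∈ S ω} (Q.ξ 0) ω) ∂Q.P := by
  rw [meanBenefit, integral_sub (Q.integrable_indicator_one (hS 0)) h]
  congr 1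
  exact (integral_indicator_one (hS 0)).symm

theorem epsilon_eq (hν : IsPosDiffuse ν) (hc : c < 1 / 2) (hνc : 0 < ν (Set.Iic c)) (hθ : 0 < θ) :
    Q.epsilon = ∫ ω, localTerm lossTerm (fun i => Q.ξ i ω) (Q.A ω) (Q.B ω) 0 ∂Q.P := by
  have h := Q.ae_cost_le hν hc hνc hθ
  have hA := Q.integrable_indicator_cost Q.measurable_A zero_le_one
    (h.mono fun ω hω => ⟨hω.1, hω.2.1⟩)
  have hB := Q.integrable_indicator_cost Q.measurable_B (show 0 ≤ 1 + θ by linarith)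
    (h.mono fun ω hω => ⟨hω.1, hω.2.2⟩)
  rw [epsilon, Q.meanBenefit_eq Q.measurable_A hA, Q.meanBenefit_eq Q.measurable_B hB,
    ← integral_sub (by exact (Q.integrable_indicator_one (Q.measurable_A 0)).sub hA)
      (by exact (Q.integrable_indicator_one (Q.measurable_B 0)).sub hB)]
  refine integral_congr_ae (Eventually.of_forall fun ω => ?_)
  by_cases h1 : (0 : ℤ) ∈ Q.A ω <;> by_cases h2 : (0 : ℤ) ∈ Q.B ω <;>
    by_cases h3 : (1 : ℤ) ∈ Q.A ω <;> by_cases h4 : (1 : ℤ) ∈ Q.B ω <;>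
    simp [localTerm, lossTerm, Set.indicator, h1, h2, h3, h4]

end StationaryQuintuple

/-! ### Measurability and convergence in mean -/

section Mean

variable {Ω : Type*} [MeasurableSpace Ω] {P : Measure Ω}

theorem aemeasurable_card {n : ℕ} {S : Ω → Finset ℕ} (hS : ∀ i, MeasurableSet {ω | i ∈ S ω})
    (hsub : ∀ᵐ ω ∂P, S ω ⊆ Finset.Icc 1 n) : AEMeasurable (fun ω => ((S ω).card : ℝ)) P := by
  refine ⟨fun ω => ∑ i ∈ Finset.Ico 1 (n + 1), if i ∈ S ω then 1 else 0,
    Finset.measurable_fun_sum _ fun i _ => Measurable.ite (hS i) measurable_const measurable_const,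
    ?_⟩
  filter_upwards [hsub] with ω h
  rw [← sum_eq_sum_Icc h fun _ => 1]
  simp

theorem measurableSet_mem_symmDiff {S T : Ω → Finset ℕ} (hS : ∀ i, MeasurableSet {ω | i ∈ S ω})
    (hT : ∀ i, MeasurableSet {ω | i ∈ T ω}) (i : ℕ) :
    MeasurableSet {ω | i ∈ symmDiff (S ω) (T ω)} := by
  simp only [Finset.mem_symmDiff]
  exact ((hS i).inter (hT i).compl).union ((hT i).inter (hS i).compl)

theorem aemeasurable_benefit {n : ℕ} {ξ : ℕ → Ω → ℝ} (hξ : ∀ i, 1 ≤ i → Measurable (ξ i))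
    {S : Ω → Finset ℕ} (hS : ∀ i, MeasurableSet {ω | i ∈ S ω})
    (hsub : ∀ᵐ ω ∂P, S ω ⊆ Finset.Icc 1 n) :
    AEMeasurable (fun ω => benefit n (fun i => ξ i ω) (S ω)) P := by
  refine (aemeasurable_card hS hsub).sub (Measurable.aemeasurable ?_)
  refine Finset.measurable_fun_sum _ fun i hi => ?_
  exact Measurable.ite ((hS i).inter (hS (i + 1))) (hξ i (Finset.mem_Ico.1 hi).1) measurable_const

theorem ConvergesAS.convergesL1 [IsFiniteMeasure P] {Y : ℕ → Ω → ℝ} {l K : ℝ}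
    (hm : ∀ n, AEMeasurable (Y n) P) (hK : ∀ n, ∀ᵐ ω ∂P, |Y n ω| ≤ K) (h : ConvergesAS P Y l) :
    ConvergesL1 P Y l := by
  unfold ConvergesL1
  simp only [eLpNorm_one_eq_lintegral_enorm]
  have h0 : (0 : ENNReal) = ∫⁻ _, 0 ∂P := by simp
  rw [h0]
  refine tendsto_lintegral_of_dominated_convergence' (fun _ => ENNReal.ofReal (K + |l|))
    (fun n => ((hm n).sub_const l).enorm) (fun n => ?_) ?_ ?_
  · filter_upwards [hK n] with ω hω
    rw [Real.enorm_eq_ofReal_abs]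
    refine ENNReal.ofReal_le_ofReal ?_
    have := abs_sub (Y n ω) l
    linarith
  · rw [lintegral_const]
    exact ENNReal.mul_ne_top ENNReal.ofReal_ne_top (measure_ne_top _ _)
  · filter_upwards [h] with ω hω
    have := (hω.sub_const l).enorm
    simpa using this

theorem ConvergesL1.tendsto_integral [IsFiniteMeasure P] {Y : ℕ → Ω → ℝ} {l : ℝ}
    (hi : ∀ n, Integrable (Y n) P) (h : ConvergesL1 P Y l) :
    Tendsto (fun n => ∫ ω, Y n ω ∂P) atTop (𝓝 (∫ _, l ∂P)) := by
  unfold ConvergesL1 at h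
  simp only [eLpNorm_one_eq_lintegral_enorm] at h
  exact tendsto_integral_of_L1 _ aestronglyMeasurable_const (Eventually.of_forall hi) h

theorem ofReal_integral_le_lintegral {f : Ω → ℝ} (hf : Integrable f P) :
    ENNReal.ofReal (∫ ω, f ω ∂P) ≤ ∫⁻ ω, ENNReal.ofReal (f ω) ∂P := by
  rw [integral_eq_lintegral_pos_part_sub_lintegral_neg_part hf]
  refine (ENNReal.ofReal_le_ofReal (sub_le_self _ ENNReal.toReal_nonneg)).trans ?_
  exact ENNReal.ofReal_toReal_le

end Mean

/-- The normalized distance of a subset of `{1,…,n}` is at most `1`. -/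
theorem normalized_card_le {n : ℕ} {A B : Finset ℕ} (hA : A ⊆ Finset.Icc 1 n)
    (hB : B ⊆ Finset.Icc 1 n) : (n : ℝ)⁻¹ * ((symmDiff B A).card : ℝ) ≤ 1 := by
  have h := Finset.card_le_card
    ((Finset.symmDiff_subset_union (s := B) (t := A)).trans (Finset.union_subset hB hA))
  rw [Nat.card_Icc, Nat.add_sub_cancel] at h
  have h' : ((symmDiff B A).card : ℝ) ≤ n := by exact_mod_cast h
  rcases Nat.eq_zero_or_pos n with rfl | hn
  · simp
  · rw [inv_mul_le_iff₀ (by exact_mod_cast hn), mul_one]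
    exact h'

/-! ### The loss of competing sets -/

/-- A set at distance `d'` from `A` loses at least as much as a maximizer of the modified objective,
corrected by the difference of the distances. -/
theorem IsModifiedOptimal.loss_le {n : ℕ} {x : ℕ → ℝ} {θ : ℝ} {A B T : Finset ℕ}
    (h : IsModifiedOptimal n x θ A B) (hT : T ⊆ Finset.Icc 1 n) (M : ℝ) :
    (n : ℝ)⁻¹ * (M - benefit n x B) - θ * ((n : ℝ)⁻¹ * ((symmDiff B A).card : ℝ)) +
      θ * ((n : ℝ)⁻¹ * ((symmDiff T A).card : ℝ)) ≤ (n : ℝ)⁻¹ * (M - benefit n x T) := by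
  have h1 := h.2 T hT
  unfold modifiedBenefit at h1
  have h2 : (0 : ℝ) ≤ (n : ℝ)⁻¹ := by positivity
  nlinarith [mul_le_mul_of_nonneg_left h1 h2]

/-- Integrating the pointwise Lagrangian bound, the terms `θ * D` and `θ * D'` cancel in the limit
since both distances tend to `δ`. The loss `G` may fail to be integrable, so only the bounding
expression is integrated in `ℝ`. -/
theorem liminf_loss_ge {Ω : Type*} [MeasurableSpace Ω] {P : Measure Ω} {θ δ ε : ℝ}
    [IsProbabilityMeasure P] {U D D' G : ℕ → Ω → ℝ}
    (hU : ∀ n, Integrable (U n) P) (hD : ∀ n, Integrable (D n) P) (hD' : ∀ n, Integrable (D' n) P)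
    (hUl : ConvergesL1 P U ε) (hDl : ConvergesL1 P D δ) (hDl' : ConvergesL1 P D' δ)
    (hG : ∀ n, ∀ᵐ ω ∂P, U n ω - θ * D n ω + θ * D' n ω ≤ (n : ℝ)⁻¹ * G n ω) :
    ENNReal.ofReal ε ≤ liminf (fun n : ℕ => ENNReal.ofReal ((n : ℝ)⁻¹) *
      ∫⁻ ω, ENNReal.ofReal (G n ω) ∂P) atTop := by
  have hi : ∀ n, Integrable (fun ω => U n ω - θ * D n ω + θ * D' n ω) P := fun n =>
    ((hU n).sub ((hD n).const_mul θ)).add ((hD' n).const_mul θ)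
  have hlim : Tendsto (fun n => ∫ ω, (U n ω - θ * D n ω + θ * D' n ω) ∂P) atTop (𝓝 ε) := by
    have h := ((hUl.tendsto_integral hU).sub ((hDl.tendsto_integral hD).const_mul θ)).add
      ((hDl'.tendsto_integral hD').const_mul θ)
    simp only [integral_const, probReal_univ, one_smul, sub_add_cancel] at h
    refine h.congr fun n => ?_
    rw [integral_add (by exact (hU n).sub ((hD n).const_mul θ)) ((hD' n).const_mul θ),
      integral_sub (hU n) ((hD n).const_mul θ), integral_const_mul, integral_const_mul]
  rw [← (ENNReal.tendsto_ofReal hlim).liminf_eq]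
  refine liminf_le_liminf (Eventually.of_forall fun n => ?_)
  rw [← lintegral_const_mul' _ _ ENNReal.ofReal_ne_top]
  refine (ofReal_integral_le_lintegral (hi n)).trans (lintegral_mono_ae ?_)
  filter_upwards [hG n] with ω hω
  rw [← ENNReal.ofReal_mul (by positivity)]
  exact ENNReal.ofReal_le_ofReal hω


/-! ### Assembly of the proposition -/

theorem mainTheorem3
    {Ω : Type u} [MeasurableSpace Ω] (P : Measure Ω) [IsProbabilityMeasure P]
    (ν : Measure ℝ) (hν : IsCostLaw ν)
    -- the i.i.d. costs `ξ_1, ξ_2, …` (the value `ξ 0` is not used)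
    (ξ : ℕ → Ω → ℝ)
    (hξ_meas : ∀ i, 1 ≤ i → Measurable (ξ i))
    (hξ_law : ∀ i, 1 ≤ i → P.map (ξ i) = ν)
    (hξ_indep : iIndepFun (fun i : ℕ => ξ (i + 1)) P)
    (τ : ℝ) (hτ : 0 < τ) (hGτ : 0 < ν (Set.Iic (1 / 2 - τ)))
    (θ : ℝ) (hθ : 0 < θ) (hθτ : θ < τ)
    -- the random sets `A_n^opt` and `B_n^opt`
    (A B : ℕ → Ω → Finset ℕ)
    (hA_meas : ∀ n i, MeasurableSet {ω | i ∈ A n ω})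
    (hB_meas : ∀ n i, MeasurableSet {ω | i ∈ B n ω})
    (hA : ∀ n, ∀ᵐ ω ∂P, IsOptimal n (fun i => ξ i ω) (A n ω))
    (hB : ∀ n, ∀ᵐ ω ∂P, IsModifiedOptimal n (fun i => ξ i ω) θ (A n ω) (B n ω))
    -- a tie-breaking rule is needed only if `1 / θ` is an odd integer
    (hB_tie : (∃ k : ℕ, θ * (2 * (k : ℝ) + 1) = 1) →
      ∀ n, ∀ᵐ ω ∂P, IsPreferred n (fun i => ξ i ω) θ (A n ω) (B n ω)) :
    Nonempty (StationaryQuintuple.{0} ν θ) ∧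
    ∀ Q : StationaryQuintuple.{v} ν θ,
      (ConvergesAS P (fun n ω => (n : ℝ)⁻¹ * ((symmDiff (B n ω) (A n ω)).card : ℝ)) Q.delta ∧
        ConvergesL1 P (fun n ω => (n : ℝ)⁻¹ * ((symmDiff (B n ω) (A n ω)).card : ℝ)) Q.delta) ∧
      (ConvergesAS P (fun n ω => (n : ℝ)⁻¹ *
          (maxBenefit n (fun i => ξ i ω) - benefit n (fun i => ξ i ω) (B n ω))) Q.epsilon ∧
        ConvergesL1 P (fun n ω => (n : ℝ)⁻¹ *
          (maxBenefit n (fun i => ξ i ω) - benefit n (fun i => ξ i ω) (B n ω))) Q.epsilon) ∧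
      -- any competing random sets `B'_n` at the same asymptotic distance from `A_n^opt`; the
      -- expectation of the nonnegative loss is taken in `[0, ∞]`
      ∀ B' : ℕ → Ω → Finset ℕ,
        (∀ n i, MeasurableSet {ω | i ∈ B' n ω}) →
        (∀ n, ∀ᵐ ω ∂P, B' n ω ⊆ Finset.Icc 1 n) →
        ConvergesL1 P (fun n ω => (n : ℝ)⁻¹ * ((symmDiff (B' n ω) (A n ω)).card : ℝ)) Q.delta →
        ENNReal.ofReal Q.epsilon ≤
          liminf (fun n : ℕ => ENNReal.ofReal ((n : ℝ)⁻¹) *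
            ∫⁻ ω, ENNReal.ofReal
              (maxBenefit n (fun i => ξ i ω) - benefit n (fun i => ξ i ω) (B' n ω)) ∂P) atTop := by
  set c : ℝ := 1 / 2 - τ with hc_def
  have hν' := hν.isPosDiffuse
  have hc : c + θ < 1 / 2 := by linarith
  have hc2 : c < 1 / 2 := by linarith
  -- Costs are positive, so a negative threshold would have probability zero.
  have hc0 : 0 ≤ c := by
    by_contra hneg
    have h0 : ν (Set.Iic c) = 0 :=
      measure_mono_null (fun t ht => not_lt.2 (le_trans ht (not_le.1 hneg).le)) (ae_iff.1 hν'.pos)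
    exact hGτ.ne' h0
  have hiid : IsIID P ν fun i => ξ (i + 1) :=
    ⟨fun i => hξ_meas _ (by lia), fun i => hξ_law _ (by lia), hξ_indep⟩
  refine ⟨hν'.nonempty_stationaryQuintuple hθ hc hc0 hGτ, fun Q => ?_⟩
  have hdiff := Q.ae_tendsto (P := P) hν' hθ hc hc0 hGτ measurable_diffTerm zero_le_one
    (Eventually.of_forall fun ω => abs_diffTerm_le _ _ _ _ _) hiid
  have hloss := Q.ae_tendsto (P := P) (C := 1 + θ) hν' hθ hc hc0 hGτ measurable_lossTerm
    (by linarith) ((Q.ae_cost_le hν' hc2 hGτ hθ).mono fun ω h =>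
      abs_lossTerm_le h.1 hθ.le h.2.1 h.2.2) hiid
  rw [← Q.delta_eq] at hdiff
  rw [← Q.epsilon_eq hν' hc2 hGτ hθ] at hloss
  have hpref : ∀ᵐ ω ∂P, ∀ n, (∃ k : ℕ, θ * (2 * (k : ℝ) + 1) = 1) →
      IsPreferred n (fun i => ξ i ω) θ (A n ω) (B n ω) := by
    by_cases h : ∃ k : ℕ, θ * (2 * (k : ℝ) + 1) = 1
    · exact (ae_all_iff.2 (hB_tie h)).mono fun ω hω n _ => hω n
    · exact Eventually.of_forall fun ω n h' => absurd h' h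
  have hAS : ∀ᵐ ω ∂P,
      Tendsto (fun n : ℕ => (n : ℝ)⁻¹ * ((symmDiff (B n ω) (A n ω)).card : ℝ)) atTop
        (𝓝 Q.delta) ∧
      Tendsto (fun n : ℕ => (n : ℝ)⁻¹ *
        (maxBenefit n (fun i => ξ i ω) - benefit n (fun i => ξ i ω) (B n ω))) atTop
        (𝓝 Q.epsilon) := by
    filter_upwards [hdiff, hloss, hpref, ae_all_iff.2 hA, ae_all_iff.2 hB,
      hiid.ae_isGenericOn hν' θ] with ω hdiff hloss hpref hA hB hgen
    have hg : IsGenericOn θ (fun i => ξ i ω) (Set.Ici 1) := isGenericOn_of_succ (x := fun i => ξ i ω) hgen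
    have hex : ∀ n : ℕ, ∃ (XR ZR : ℤ → ℝ) (B₁ : Finset ℕ), 1 ≤ n → B₁ ⊆ Finset.Icc 1 n ∧
        IsLocalSystem θ (extendInt fun i => ξ i ω) XR ZR (intItems (A n ω)) (intItems B₁) 1 n ∧
        (symmDiff (B n ω) (A n ω)).card = (symmDiff B₁ (A n ω)).card ∧
        benefit n (fun i => ξ i ω) (B n ω) = benefit n (fun i => ξ i ω) B₁ ∧
        (∀ i, i ∈ A n ω → i + 1 ∈ A n ω → ξ i ω ≤ 1) ∧
        ∀ i, i ∈ B₁ → i + 1 ∈ B₁ → ξ i ω ≤ 1 + θ := fun n => by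
      by_cases hn : 1 ≤ n
      · obtain ⟨XR, ZR, B₁, h⟩ := exists_isLocalSystem hn hθ hg (hA n) (hB n) (hpref n)
        exact ⟨XR, ZR, B₁, fun _ => h⟩
      -- Placeholders for `n = 0`, where nothing is claimed.
      · exact ⟨0, 0, ∅, fun h => absurd h hn⟩
    choose XR ZR B₁ hsub hsys hcard hben hbA hbB using hex
    constructor
    · refine hdiff (fun n => intItems (A n ω)) (fun n => intItems (B₁ n)) XR ZR _ hsys
        (fun n i _ _ => abs_diffTerm_le _ _ _ _ _) fun n hn => ?_
      rw [hcard n hn]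
      exact abs_card_sub_sum_le hn _ (hA n).1 (hsub n hn)
    · refine hloss (fun n => intItems (A n ω)) (fun n => intItems (B₁ n)) XR ZR _ hsys
        (fun n i h1 hin => ?_) fun n hn => ?_
      · have e : ((i : ℤ) + 1).toNat = i + 1 := by lia
        refine abs_lossTerm_le (hg.pos i h1).le hθ.le (fun h0 h1' => ?_) fun h0 h1' => ?_
        · rw [mem_intItems, e] at h1'
          exact hbA n (by lia) i h0 h1'
        · rw [mem_intItems, e] at h1'
          exact hbB n (by lia) i h0 h1'
      · rw [maxBenefit_eq (hA n), hben n hn]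
        exact abs_benefit_sub_sum_le hn _ (hA n).1 (hsub n hn)
  have hAsub : ∀ n, ∀ᵐ ω ∂P, A n ω ⊆ Finset.Icc 1 n := fun n => (hA n).mono fun ω h => h.1
  have hcardm : ∀ S : ℕ → Ω → Finset ℕ, (∀ n i, MeasurableSet {ω | i ∈ S n ω}) →
      (∀ n, ∀ᵐ ω ∂P, S n ω ⊆ Finset.Icc 1 n) → ∀ n : ℕ, AEMeasurable
        (fun ω => (n : ℝ)⁻¹ * ((symmDiff (S n ω) (A n ω)).card : ℝ)) P := fun S hS hSs n => by
    refine (aemeasurable_card (n := n) (measurableSet_mem_symmDiff (hS n) (hA_meas n)) ?_).const_mul _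
    filter_upwards [hSs n, hAsub n] with ω h1 h2
    exact Finset.symmDiff_subset_union.trans (Finset.union_subset h1 h2)
  have hcardb : ∀ S : ℕ → Ω → Finset ℕ, (∀ n, ∀ᵐ ω ∂P, S n ω ⊆ Finset.Icc 1 n) → ∀ n : ℕ, ∀ᵐ ω ∂P,
      |(n : ℝ)⁻¹ * ((symmDiff (S n ω) (A n ω)).card : ℝ)| ≤ 1 := fun S hSs n => by
    filter_upwards [hSs n, hAsub n] with ω h1 h2
    rw [abs_of_nonneg (by positivity)]
    exact normalized_card_le h2 h1
  have hBsub : ∀ n, ∀ᵐ ω ∂P, B n ω ⊆ Finset.Icc 1 n := fun n => (hB n).mono fun ω h => h.1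
  have hlossm : ∀ n : ℕ, AEMeasurable (fun ω => (n : ℝ)⁻¹ *
      (maxBenefit n (fun i => ξ i ω) - benefit n (fun i => ξ i ω) (B n ω))) P := fun n => by
    refine (AEMeasurable.sub ?_ (aemeasurable_benefit hξ_meas (hB_meas n) (hBsub n))).const_mul _
    exact (aemeasurable_benefit hξ_meas (hA_meas n) (hAsub n)).congr
      ((hA n).mono fun ω h => (maxBenefit_eq h).symm)
  have hlossb : ∀ n : ℕ, ∀ᵐ ω ∂P, |(n : ℝ)⁻¹ *
      (maxBenefit n (fun i => ξ i ω) - benefit n (fun i => ξ i ω) (B n ω))| ≤ θ := fun n => by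
    filter_upwards [hA n, hB n] with ω h1 h2
    rw [maxBenefit_eq h1]
    -- Comparing `B` with `A` itself, at distance zero, bounds the normalized loss by `θ` times the
    -- normalized distance.
    have h3 := h2.loss_le h1.1 (benefit n (fun i => ξ i ω) (A n ω))
    have h4 := normalized_card_le h1.1 h2.1
    have h5 := h1.2 _ h2.1
    rw [abs_of_nonneg (mul_nonneg (by positivity) (by linarith))]
    simp only [symmDiff_self, Finset.bot_eq_empty, Finset.card_empty, Nat.cast_zero, mul_zero,
      add_zero, sub_self] at h3
    nlinarith
  have hdAS : ConvergesAS P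
      (fun n ω => (n : ℝ)⁻¹ * ((symmDiff (B n ω) (A n ω)).card : ℝ)) Q.delta :=
    hAS.mono fun ω h => h.1
  have heAS : ConvergesAS P (fun n ω => (n : ℝ)⁻¹ *
      (maxBenefit n (fun i => ξ i ω) - benefit n (fun i => ξ i ω) (B n ω))) Q.epsilon :=
    hAS.mono fun ω h => h.2
  have hdL := hdAS.convergesL1 (hcardm B hB_meas hBsub) (hcardb B hBsub)
  have heL := heAS.convergesL1 hlossm hlossb
  refine ⟨⟨hdAS, hdL⟩, ⟨heAS, heL⟩, fun B' hB'_meas hB'sub hB'L => ?_⟩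
  refine liminf_loss_ge (θ := θ)
    (fun n => Integrable.of_bound (hlossm n).aestronglyMeasurable θ (hlossb n))
    (fun n => Integrable.of_bound (hcardm B hB_meas hBsub n).aestronglyMeasurable 1
      (hcardb B hBsub n))
    (fun n => Integrable.of_bound (hcardm B' hB'_meas hB'sub n).aestronglyMeasurable 1
      (hcardb B' hB'sub n)) heL hdL hB'L fun n => ?_
  filter_upwards [hB n, hB'sub n] with ω h1 h2
  exact h1.loss_le h2 _
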